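/- Let $\Omega\subset\mathbb R^2$ be an open regular hexagon of side $L$. For $m\ge 1$ let $\mathcal T_h$, $h=L/m$, be its structured mesh of $6m^2$ equilateral triangles of side $h$, and let $\varphi_i$ be the piecewise linear nodal basis functions of its $n=3m(m-1)+1$ internal nodes. Let $a\in C^2(\overline\Omega)$ be real-valued with $a\ge a_0>0$ on $\overline\Omega$, and let $\mathbf b\in C^1(\overline\Omega)$ be a real vector field with $\operatorname{div}\mathbf b\ge 0$ in $\Omega$. Set $$A_n(a,\mathbf b)=\Theta_n(a)+\Psi_n(\mathbf b),\qquad (\Theta_n(a))_{ij}=\int_\Omega a\,\nabla\varphi_j\cdot\nabla\varphi_i,\qquad (\Psi_n(\mathbf b))_{ij}=-\int_\Omega(\mathbf b\cdot\nabla\varphi_i)\,\varphi_j ,$$ $$\operatorname{Im}(A)=\frac{A-A^H}{2\mathrm i},\qquad P_n(a)=D_n^{1/2}(a)\,A_n(1,0)\,D_n^{1/2}(a),\qquad D_n(a)=\operatorname{diag}(A_n(a,0))\,\operatorname{diag}(A_n(1,0))^{-1}.$$ Then $P_n(a)$ is symmetric positive definite, $\operatorname{Im}(A_n(a,\mathbf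 b))$ is Hermitian, and, as $m$ varies, the sequence $\{P_n(a)^{-1}\operatorname{Im}(A_n(a,\mathbf b))\}$ is * spectrally bounded: there is a constant $C$ independent of $n$ such that every eigenvalue $\lambda$ of every matrix of the sequence satisfies $|\lambda|\le C$; * properly clustered at $0$: for every $\varepsilon>0$ there is $N_\varepsilon$, independent of $n$, such that at most $N_\varepsilon$ eigenvalues (counted with multiplicity) of each matrix of the sequence lie outside the disk $\{|z|<\varepsilon\}$. The same holds if the entries of $\Psi_n(\mathbf b)$, or those of $\Theta_n(a)$, or both, are evaluated not exactly but by quadrature with error $O(h^2)$. Here the integral over each triangle is replaced by a finite weighted sum of values of the integrand at nodes in that triangle, $\nabla\varphi_i$ being taken as its constant value on the triangle. The resulting matrix entries are required to differ from the exact ones by at most $ch^2$ with $c$ independent of $n,i,j$. In the case of $\Theta_n(a)$ the approximate diagonal entries are required to be positive, so that $D_n^{1/2}(a)$ and $P_n(a)^{-1}$ make sense. The constant-coefficient matrix $A_n(1,0)$ in $P_n(a)$ is always exact. -/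

import Mathlib

open MeasureTheory
open scoped InnerProductSpace

noncomputable section

/-- The Euclidean plane. -/
abbrev Plane : Type := EuclideanSpace ℝ (Fin 2)

/-- The data of a regular hexagon in the plane: its centre, its side length, and two centre-to-vertex
vectors `u`, `v` spanning an equilateral triangle (`‖u‖ = ‖v‖ = ‖u - v‖ = side`). Its six vertices are
`center ± u`, `center ± v`, `center ± (u - v)`. Size, position and orientation are arbitrary. -/
structure RegularHexagon where
  center : Plane
  u : Plane
  v : Plane
  side : ℝ
  side_pos : 0 < side
  norm_u : ‖u‖ = side
  norm_v : ‖v‖ = side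
  norm_sub : ‖u - v‖ = side

namespace RegularHexagon

variable (H : RegularHexagon)

/-- The coordinate `s` of the point `center + s • u + t • v`; see `coordU_combination`. -/
def coordU (x : Plane) : ℝ :=
  (4 * ⟪H.u, x - H.center⟫_ℝ - 2 * ⟪H.v, x - H.center⟫_ℝ) / (3 * H.side ^ 2)

/-- The coordinate `t` of the point `center + s • u + t • v`; see `coordV_combination`. -/
def coordV (x : Plane) : ℝ :=
  (4 * ⟪H.v, x - H.center⟫_ℝ - 2 * ⟪H.u, x - H.center⟫_ℝ) / (3 * H.side ^ 2)

/-- The open hexagon `Ω`. -/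
def domain : Set Plane :=
  {x | |H.coordU x| < 1 ∧ |H.coordV x| < 1 ∧ |H.coordU x + H.coordV x| < 1}

/-! ### The structured mesh of equilateral triangles of side `side / m` -/

/-- The mesh size `h` of the mesh in which every side of the hexagon is cut into `m` equal parts. -/
def meshSize (m : ℕ) : ℝ := H.side / m

/-- The mesh point with integer lattice coordinates `p`. -/
def meshPoint (m : ℕ) (p : ℤ × ℤ) : Plane :=
  H.center + ((p.1 : ℝ) / m) • H.u + ((p.2 : ℝ) / m) • H.v

end RegularHexagon

/-- The internal nodes (in lattice coordinates) of the `m`-th mesh; there are `3m(m-1)+1` of them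
for `m ≥ 1`, and none for `m = 0`. -/
def internalNodes (m : ℕ) : Finset (ℤ × ℤ) :=
  (Finset.Icc (-(m : ℤ)) m ×ˢ Finset.Icc (-(m : ℤ)) m).filter
    fun p => |p.1| < m ∧ |p.2| < m ∧ |p.1 + p.2| < m

/-- The index set of the matrices of the `m`-th mesh. -/
abbrev Node (m : ℕ) : Type := ↥(internalNodes m)

/-- The lattice coordinates of the three vertices of the elementary triangle `(p, o)`; the two
orientations `o` give the two triangles of the lattice cell with lower corner `p`. -/
def cellVertex : (ℤ × ℤ) × Bool → Fin 3 → ℤ × ℤ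
  | (p, true) => ![p, p + (1, 0), p + (0, 1)]
  | (p, false) => ![p + (1, 1), p + (0, 1), p + (1, 0)]

/-- The triangles of the `m`-th mesh: the elementary triangles contained in the closed hexagon. -/
def meshTriangles (m : ℕ) : Finset ((ℤ × ℤ) × Bool) :=
  ((Finset.Icc (-(m : ℤ)) m ×ˢ Finset.Icc (-(m : ℤ)) m) ×ˢ Finset.univ).filter
    fun T => ∀ k, |(cellVertex T k).1| ≤ m ∧ |(cellVertex T k).2| ≤ m ∧
      |(cellVertex T k).1 + (cellVertex T k).2| ≤ m

namespace RegularHexagon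

variable (H : RegularHexagon)

/-- The closed triangle of the plane represented by `T`. -/
def triangle (m : ℕ) (T : (ℤ × ℤ) × Bool) : Set Plane :=
  convexHull ℝ (Set.range fun k => H.meshPoint m (cellVertex T k))

/-- The nodal (hat) basis function of the node `p`: the continuous function, affine on every mesh
triangle, that is `1` at the node `p` and `0` at all other mesh points; see `hat_meshPoint`,
`continuous_hat` and `exists_affine_eq_hat`. -/
def hat (m : ℕ) (p : ℤ × ℤ) (x : Plane) : ℝ :=
  max 0 (1 - max |m * H.coordU x - p.1| (max |m * H.coordV x - p.2|
    |(m * H.coordU x - p.1) + (m * H.coordV x - p.2)|))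

/-! Basic facts: the definitions above describe what they are meant to describe. -/

theorem inner_u_v : ⟪H.u, H.v⟫_ℝ = H.side ^ 2 / 2 := by
  have h := norm_sub_sq_real H.u H.v
  rw [H.norm_u, H.norm_v, H.norm_sub] at h
  linarith

theorem coordU_combination (s t : ℝ) : H.coordU (H.center + s • H.u + t • H.v) = s := by
  have h0 := H.side_pos
  have e : H.center + s • H.u + t • H.v - H.center = s • H.u + t • H.v := by abel
  have h1 : ⟪H.v, H.u⟫_ℝ = H.side ^ 2 / 2 := by rw [real_inner_comm]; exact H.inner_u_v
  simp only [coordU, e, inner_add_right, inner_smul_right, H.inner_u_v, h1,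
    real_inner_self_eq_norm_sq, H.norm_u, H.norm_v]
  field_simp
  ring

theorem coordV_combination (s t : ℝ) : H.coordV (H.center + s • H.u + t • H.v) = t := by
  have h0 := H.side_pos
  have e : H.center + s • H.u + t • H.v - H.center = s • H.u + t • H.v := by abel
  have h1 : ⟪H.v, H.u⟫_ℝ = H.side ^ 2 / 2 := by rw [real_inner_comm]; exact H.inner_u_v
  simp only [coordV, e, inner_add_right, inner_smul_right, H.inner_u_v, h1,
    real_inner_self_eq_norm_sq, H.norm_u, H.norm_v]
  field_simp
  ring

theorem continuous_hat (m : ℕ) (p : ℤ × ℤ) : Continuous (H.hat m p) := by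
  unfold hat coordU coordV
  fun_prop

theorem hat_meshPoint {m : ℕ} (hm : m ≠ 0) (p q : ℤ × ℤ) :
    H.hat m p (H.meshPoint m q) = if q = p then 1 else 0 := by
  have hm' : (m : ℝ) ≠ 0 := by exact_mod_cast hm
  simp only [hat, meshPoint, coordU_combination, coordV_combination, mul_div_cancel₀ _ hm']
  split_ifs with h
  · subst h; simp
  · apply max_eq_left
    have : q.1 ≠ p.1 ∨ q.2 ≠ p.2 := by
      by_contra! hc
      exact h (Prod.ext hc.1 hc.2)
    rw [sub_nonpos]
    rcases this with h1 | h1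
    · refine le_trans ?_ (le_max_left _ _)
      exact_mod_cast Int.one_le_abs (sub_ne_zero.mpr h1)
    · refine le_trans ?_ ((le_max_left _ _).trans (le_max_right _ _))
      exact_mod_cast Int.one_le_abs (sub_ne_zero.mpr h1)


theorem eq_combination (x : Plane) :
    x = H.center + H.coordU x • H.u + H.coordV x • H.v := by
  have h0 := H.side_pos
  have h1 : ⟪H.v, H.u⟫_ℝ = H.side ^ 2 / 2 := by rw [real_inner_comm]; exact H.inner_u_v
  have huu : ⟪H.u, H.u⟫_ℝ = H.side ^ 2 := by rw [real_inner_self_eq_norm_sq, H.norm_u]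
  have hvv : ⟪H.v, H.v⟫_ℝ = H.side ^ 2 := by rw [real_inner_self_eq_norm_sq, H.norm_v]
  have hli : LinearIndependent ℝ ![H.u, H.v] := by
    rw [LinearIndependent.pair_iff]
    intro s t hst
    have hs := H.coordU_combination s t
    have ht := H.coordV_combination s t
    have hs0 := H.coordU_combination 0 0
    have ht0 := H.coordV_combination 0 0
    rw [add_assoc, hst] at hs ht
    simp only [zero_smul, add_zero] at hs ht hs0 ht0
    exact ⟨by rw [← hs, hs0], by rw [← ht, ht0]⟩
  have hspan : Submodule.span ℝ (Set.range ![H.u, H.v]) = ⊤ :=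
    hli.span_eq_top_of_card_eq_finrank' (by simp)
  have hmem : x - H.center ∈ Submodule.span ℝ (Set.range ![H.u, H.v]) := by rw [hspan]; trivial
  rw [Matrix.range_cons, Matrix.range_cons, Matrix.range_empty, Set.union_empty,
    Set.singleton_union, Submodule.mem_span_pair] at hmem
  obtain ⟨s, t, hst⟩ := hmem
  have hx : x = H.center + s • H.u + t • H.v := by rw [add_assoc, hst]; abel
  rw [hx, coordU_combination, coordV_combination]

/-- The open hexagon is made of the points `center + s • u + t • v` with `|s|, |t|, |s + t| < 1`. -/
theorem mem_domain_iff (x : Plane) : x ∈ H.domain ↔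
    ∃ s t : ℝ, |s| < 1 ∧ |t| < 1 ∧ |s + t| < 1 ∧ x = H.center + s • H.u + t • H.v := by
  constructor
  · rintro ⟨h1, h2, h3⟩
    exact ⟨_, _, h1, h2, h3, H.eq_combination x⟩
  · rintro ⟨s, t, h1, h2, h3, rfl⟩
    simp only [domain, Set.mem_ofPred_eq, coordU_combination, coordV_combination]
    exact ⟨h1, h2, h3⟩

theorem coordU_eq (x : Plane) : H.coordU x =
    ⟪(3 * H.side ^ 2)⁻¹ • ((4 : ℝ) • H.u - (2 : ℝ) • H.v), x⟫_ℝ +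
      -⟪(3 * H.side ^ 2)⁻¹ • ((4 : ℝ) • H.u - (2 : ℝ) • H.v), H.center⟫_ℝ := by
  simp only [coordU, inner_sub_right, inner_sub_left, real_inner_smul_left]
  ring

theorem coordV_eq (x : Plane) : H.coordV x =
    ⟪(3 * H.side ^ 2)⁻¹ • ((4 : ℝ) • H.v - (2 : ℝ) • H.u), x⟫_ℝ +
      -⟪(3 * H.side ^ 2)⁻¹ • ((4 : ℝ) • H.v - (2 : ℝ) • H.u), H.center⟫_ℝ := by
  simp only [coordV, inner_sub_right, inner_sub_left, real_inner_smul_left]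
  ring

/-- In lattice coordinates a mesh triangle is `{α ≥ 0, β ≥ 0, α + β ≤ 1}` or its reflection. -/
theorem coord_of_mem_triangle {m : ℕ} (hm : m ≠ 0) (p : ℤ × ℤ) (o : Bool) {x : Plane}
    (hx : x ∈ H.triangle m (p, o)) :
    if o then 0 ≤ m * H.coordU x - p.1 ∧ 0 ≤ m * H.coordV x - p.2 ∧
        m * H.coordU x - p.1 + (m * H.coordV x - p.2) ≤ 1
      else m * H.coordU x - p.1 ≤ 1 ∧ m * H.coordV x - p.2 ≤ 1 ∧
        1 ≤ m * H.coordU x - p.1 + (m * H.coordV x - p.2) := by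
  have hm' : (m : ℝ) ≠ 0 := by exact_mod_cast hm
  have aff : ∀ A B : ℝ, ∀ y z : Plane, ∀ a b : ℝ, a + b = 1 →
      A * H.coordU (a • y + b • z) + B * H.coordV (a • y + b • z) =
        a * (A * H.coordU y + B * H.coordV y) + b * (A * H.coordU z + B * H.coordV z) := by
    intro A B y z a b hab
    simp only [coordU_eq, coordV_eq, inner_add_right, inner_smul_right]
    obtain rfl : b = 1 - a := by linarith
    ring
  have half : ∀ A B c : ℝ,
      (∀ k, A * H.coordU (H.meshPoint m (cellVertex (p, o) k)) +
        B * H.coordV (H.meshPoint m (cellVertex (p, o) k)) ≤ c) →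
      A * H.coordU x + B * H.coordV x ≤ c := by
    intro A B c hk
    have hsub : H.triangle m (p, o) ⊆ {y | A * H.coordU y + B * H.coordV y ≤ c} := by
      refine convexHull_min ?_ ?_
      · rintro _ ⟨k, rfl⟩
        exact hk k
      · intro y hy z hz a b ha hb hab
        simp only [Set.mem_ofPred_eq] at hy hz ⊢
        rw [aff A B y z a b hab]
        have e1 := mul_le_mul_of_nonneg_left hy ha
        have e2 := mul_le_mul_of_nonneg_left hz hb
        have e3 : a * c + b * c = c := by rw [← add_mul, hab, one_mul]
        linarith
    exact hsub hx
  have key : ∀ q : ℤ × ℤ, m * H.coordU (H.meshPoint m q) = q.1 ∧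
      m * H.coordV (H.meshPoint m q) = q.2 := by
    intro q
    simp only [meshPoint, coordU_combination, coordV_combination, mul_div_cancel₀ _ hm', and_self]
  cases o
  · have h1 := half m 0 (p.1 + 1) (by
      intro k; rw [(key _).1]; fin_cases k <;> simp [cellVertex])
    have h2 := half 0 m (p.2 + 1) (by
      intro k; rw [(key _).2]; fin_cases k <;> simp [cellVertex])
    have h3 := half (-m) (-m) (-(p.1 + p.2 + 1)) (by
      intro k; rw [neg_mul, neg_mul, (key _).1, (key _).2]
      fin_cases k <;> simp [cellVertex] <;> linarith)
    simp only [Bool.false_eq_true, if_false]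
    refine ⟨?_, ?_, ?_⟩ <;> linarith
  · have h1 := half (-m) 0 (-p.1) (by
      intro k; rw [neg_mul, (key _).1]; fin_cases k <;> simp [cellVertex])
    have h2 := half 0 (-m) (-p.2) (by
      intro k; rw [neg_mul, (key _).2]; fin_cases k <;> simp [cellVertex])
    have h3 := half m m (p.1 + p.2 + 1) (by
      intro k; rw [(key _).1, (key _).2]
      fin_cases k <;> simp [cellVertex] <;> linarith)
    simp only [if_true]
    refine ⟨?_, ?_, ?_⟩ <;> linarith

/-- Every basis function is affine on every mesh triangle. -/
theorem exists_affine_eq_hat {m : ℕ} (hm : m ≠ 0) (q : ℤ × ℤ) (T : (ℤ × ℤ) × Bool) :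
    ∃ (g : Plane) (c : ℝ), ∀ x ∈ H.triangle m T, H.hat m q x = ⟪g, x⟫_ℝ + c := by
  obtain ⟨p, o⟩ := T
  suffices h : ∃ A B C : ℝ, ∀ x ∈ H.triangle m (p, o),
      H.hat m q x = A * H.coordU x + B * H.coordV x + C by
    obtain ⟨A, B, C, h⟩ := h
    refine ⟨A • ((3 * H.side ^ 2)⁻¹ • ((4 : ℝ) • H.u - (2 : ℝ) • H.v)) +
      B • ((3 * H.side ^ 2)⁻¹ • ((4 : ℝ) • H.v - (2 : ℝ) • H.u)),
      C + A * -⟪(3 * H.side ^ 2)⁻¹ • ((4 : ℝ) • H.u - (2 : ℝ) • H.v), H.center⟫_ℝ +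
        B * -⟪(3 * H.side ^ 2)⁻¹ • ((4 : ℝ) • H.v - (2 : ℝ) • H.u), H.center⟫_ℝ,
      fun x hx => ?_⟩
    · rw [h x hx, coordU_eq, coordV_eq, inner_add_left]
      simp only [real_inner_smul_left]
      ring
  have zero : (∀ x ∈ H.triangle m (p, o), 1 ≤ |m * H.coordU x - q.1| ∨
      1 ≤ |m * H.coordV x - q.2| ∨ 1 ≤ |m * H.coordU x - q.1 + (m * H.coordV x - q.2)|) →
      ∃ A B C : ℝ, ∀ x ∈ H.triangle m (p, o),
        H.hat m q x = A * H.coordU x + B * H.coordV x + C := by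
    intro h
    refine ⟨0, 0, 0, fun x hx => ?_⟩
    have := h x hx
    simp only [hat]
    grind
  have val : ∀ r s t : ℝ, |s| ≤ r → |t| ≤ r → |s + t| ≤ r → (r = |s| ∨ r = |t| ∨ r = |s + t|) →
      r ≤ 1 → max 0 (1 - max |s| (max |t| |s + t|)) = 1 - r := by
    intro r s t h1 h2 h3 h4 h5
    have e : max |s| (max |t| |s + t|) = r := by
      apply le_antisymm (max_le h1 (max_le h2 h3))
      rcases h4 with h | h | h <;> rw [h] <;> simp
    rw [e, max_eq_right (by linarith)]
  obtain ⟨p1, p2⟩ := p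
  obtain ⟨q1, q2⟩ := q
  have cast : ∀ a b : ℤ, a ≤ b → (a : ℝ) ≤ b := fun a b h => by exact_mod_cast h
  cases o
  · have key : ∀ x ∈ H.triangle m ((p1, p2), false), _ := fun x hx =>
      H.coord_of_mem_triangle hm (p1, p2) false hx
    simp only [Bool.false_eq_true, if_false] at key
    by_cases c1 : q1 = p1 + 1 ∧ q2 = p2 + 1
    · obtain ⟨rfl, rfl⟩ := c1
      refine ⟨m, m, -p1 - p2 - 1, fun x hx => ?_⟩
      obtain ⟨k1, k2, k3⟩ := key x hx
      rw [hat, val (2 - (m * H.coordU x - p1 + (m * H.coordV x - p2)))] <;> push_cast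
      · ring
      · rw [abs_le]; constructor <;> linarith
      · rw [abs_le]; constructor <;> linarith
      · rw [abs_le]; constructor <;> linarith
      · right; right; rw [abs_of_nonpos (by linarith)]; ring
      · linarith
    by_cases c2 : q1 = p1 ∧ q2 = p2 + 1
    · obtain ⟨rfl, rfl⟩ := c2
      refine ⟨-m, 0, q1 + 1, fun x hx => ?_⟩
      obtain ⟨k1, k2, k3⟩ := key x hx
      rw [hat, val (m * H.coordU x - q1)] <;> push_cast
      · ring
      · rw [abs_le]; constructor <;> linarith
      · rw [abs_le]; constructor <;> linarith
      · rw [abs_le]; constructor <;> linarith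
      · left; rw [abs_of_nonneg (by linarith)]
      · linarith
    by_cases c3 : q1 = p1 + 1 ∧ q2 = p2
    · obtain ⟨rfl, rfl⟩ := c3
      refine ⟨0, -m, q2 + 1, fun x hx => ?_⟩
      obtain ⟨k1, k2, k3⟩ := key x hx
      rw [hat, val (m * H.coordV x - q2)] <;> push_cast
      · ring
      · rw [abs_le]; constructor <;> linarith
      · rw [abs_le]; constructor <;> linarith
      · rw [abs_le]; constructor <;> linarith
      · right; left; rw [abs_of_nonneg (by linarith)]
      · linarith
    apply zero
    intro x hx
    obtain ⟨k1, k2, k3⟩ := key x hx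
    simp only [le_abs]
    have : q1 ≤ p1 - 1 ∨ p1 + 2 ≤ q1 ∨ q2 ≤ p2 - 1 ∨ p2 + 2 ≤ q2 ∨ q1 + q2 ≤ p1 + p2 ∨
      p1 + p2 + 3 ≤ q1 + q2 := by omega
    rcases this with h | h | h | h | h | h <;> have h' := cast _ _ h <;> push_cast at h'
    · left; left; linarith
    · left; right; linarith
    · right; left; left; linarith
    · right; left; right; linarith
    · right; right; left; linarith
    · right; right; right; linarith
  · have key : ∀ x ∈ H.triangle m ((p1, p2), true), _ := fun x hx =>
      H.coord_of_mem_triangle hm (p1, p2) true hx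
    simp only [if_true] at key
    by_cases c1 : q1 = p1 ∧ q2 = p2
    · obtain ⟨rfl, rfl⟩ := c1
      refine ⟨-m, -m, q1 + q2 + 1, fun x hx => ?_⟩
      obtain ⟨k1, k2, k3⟩ := key x hx
      rw [hat, val (m * H.coordU x - q1 + (m * H.coordV x - q2))]
      · ring
      · rw [abs_le]; constructor <;> linarith
      · rw [abs_le]; constructor <;> linarith
      · rw [abs_le]; constructor <;> linarith
      · right; right; rw [abs_of_nonneg (by linarith)]
      · linarith
    by_cases c2 : q1 = p1 + 1 ∧ q2 = p2
    · obtain ⟨rfl, rfl⟩ := c2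
      refine ⟨m, 0, -p1, fun x hx => ?_⟩
      obtain ⟨k1, k2, k3⟩ := key x hx
      rw [hat, val (1 - (m * H.coordU x - p1))] <;> push_cast
      · ring
      · rw [abs_le]; constructor <;> linarith
      · rw [abs_le]; constructor <;> linarith
      · rw [abs_le]; constructor <;> linarith
      · left; rw [abs_of_nonpos (by linarith)]; ring
      · linarith
    by_cases c3 : q1 = p1 ∧ q2 = p2 + 1
    · obtain ⟨rfl, rfl⟩ := c3
      refine ⟨0, m, -p2, fun x hx => ?_⟩
      obtain ⟨k1, k2, k3⟩ := key x hx
      rw [hat, val (1 - (m * H.coordV x - p2))] <;> push_cast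
      · ring
      · rw [abs_le]; constructor <;> linarith
      · rw [abs_le]; constructor <;> linarith
      · rw [abs_le]; constructor <;> linarith
      · right; left; rw [abs_of_nonpos (by linarith)]; ring
      · linarith
    apply zero
    intro x hx
    obtain ⟨k1, k2, k3⟩ := key x hx
    simp only [le_abs]
    have : q1 ≤ p1 - 1 ∨ p1 + 2 ≤ q1 ∨ q2 ≤ p2 - 1 ∨ p2 + 2 ≤ q2 ∨ q1 + q2 ≤ p1 + p2 - 1 ∨
      p1 + p2 + 2 ≤ q1 + q2 := by omega
    rcases this with h | h | h | h | h | h <;> have h' := cast _ _ h <;> push_cast at h'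
    · left; left; linarith
    · left; right; linarith
    · right; left; left; linarith
    · right; left; right; linarith
    · right; right; left; linarith
    · right; right; right; linarith

end RegularHexagon

/-- The divergence in the plane: `∂b₁/∂x₁ + ∂b₂/∂x₂`. -/
def divergence (b : Plane → Plane) (x : Plane) : ℝ :=
  ∑ i, fderiv ℝ b x (EuclideanSpace.single i 1) i

/-- A quadrature formula on a set `K`: finitely many nodes in `K`, with real weights. -/
structure Quadrature (K : Set Plane) where
  size : ℕ
  node : Fin size → Plane
  weight : Fin size → ℝ
  node_mem : ∀ k, node k ∈ K

/-- The value of a quadrature formula on an integrand. -/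
def Quadrature.apply {K : Set Plane} (Q : Quadrature K) (f : Plane → ℝ) : ℝ :=
  ∑ k, Q.weight k * f (Q.node k)

namespace RegularHexagon

variable (H : RegularHexagon)

/-- `(Θ(a))ᵢⱼ = ∫_Ω a ∇φⱼ · ∇φᵢ`. -/
def diffusionMatrix (a : Plane → ℝ) (m : ℕ) : Matrix (Node m) (Node m) ℝ :=
  Matrix.of fun i j => ∫ x in H.domain, a x * ⟪gradient (H.hat m j) x, gradient (H.hat m i) x⟫_ℝ

/-- `(Ψ(b))ᵢⱼ = -∫_Ω (b · ∇φᵢ) φⱼ`. -/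
def convectionMatrix (b : Plane → Plane) (m : ℕ) : Matrix (Node m) (Node m) ℝ :=
  Matrix.of fun i j => -∫ x in H.domain, ⟪b x, gradient (H.hat m i) x⟫_ℝ * H.hat m j x

/-- A choice of a quadrature formula on every triangle of every mesh. -/
abbrev QuadratureFamily : Type := (m : ℕ) → (T : meshTriangles m) → Quadrature (H.triangle m T)

/-- The matrix obtained from `diffusionMatrix` by applying quadrature on every triangle. The gradient
of a basis function on a triangle is the (constant) gradient of its restriction to that triangle. -/
def quadDiffusionMatrix (Q : H.QuadratureFamily) (a : Plane → ℝ) (m : ℕ) :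
    Matrix (Node m) (Node m) ℝ :=
  Matrix.of fun i j => ∑ T : meshTriangles m, (Q m T).apply fun x =>
    a x * ⟪gradientWithin (H.hat m j) (H.triangle m T) x,
      gradientWithin (H.hat m i) (H.triangle m T) x⟫_ℝ

/-- The matrix obtained from `convectionMatrix` by applying quadrature on every triangle. -/
def quadConvectionMatrix (Q : H.QuadratureFamily) (b : Plane → Plane) (m : ℕ) :
    Matrix (Node m) (Node m) ℝ :=
  Matrix.of fun i j => -∑ T : meshTriangles m, (Q m T).apply fun x =>
    ⟪b x, gradientWithin (H.hat m i) (H.triangle m T) x⟫_ℝ * H.hat m j x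

/-- The entries of two sequences of matrices differ by `O(h²)`, uniformly in the entry. -/
def ErrorOh2 (M M' : (m : ℕ) → Matrix (Node m) (Node m) ℝ) : Prop :=
  ∃ C : ℝ, ∀ m, ∀ i j : Node m, |M m i j - M' m i j| ≤ C * H.meshSize m ^ 2

/-- `Θ` is the sequence of diffusion matrices, evaluated exactly, or else by quadrature formulas with
error `O(h²)` (and with positive diagonal, so that the scaling in the preconditioner makes sense). -/
def IsDiffusionSequence (a : Plane → ℝ) (Θ : (m : ℕ) → Matrix (Node m) (Node m) ℝ) : Prop :=
  Θ = H.diffusionMatrix a ∨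
    ∃ Q : H.QuadratureFamily, Θ = H.quadDiffusionMatrix Q a ∧
      H.ErrorOh2 Θ (H.diffusionMatrix a) ∧ ∀ m i, 0 < Θ m i i

/-- `Ψ` is the sequence of convection matrices, evaluated exactly, or else by quadrature formulas with
error `O(h²)`. -/
def IsConvectionSequence (b : Plane → Plane) (Ψ : (m : ℕ) → Matrix (Node m) (Node m) ℝ) : Prop :=
  Ψ = H.convectionMatrix b ∨
    ∃ Q : H.QuadratureFamily, Ψ = H.quadConvectionMatrix Q b ∧
      H.ErrorOh2 Ψ (H.convectionMatrix b)

/-- The preconditioner `P(a) = D^{1/2} A(1,0) D^{1/2}`, `D = diag(A(a,0)) diag(A(1,0))⁻¹`, where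
`A(a,0) = Θ` and `A(1,0)` has constant coefficients and is integrated exactly. -/
def preconditioner (m : ℕ) (Θ : Matrix (Node m) (Node m) ℝ) : Matrix (Node m) (Node m) ℝ :=
  let D := Matrix.diagonal fun i => √(Θ i i / H.diffusionMatrix (fun _ => 1) m i i)
  D * H.diffusionMatrix (fun _ => 1) m * D

end RegularHexagon

/-- `Im(A) = (A - Aᴴ) / (2i)`. -/
def imPart {ι : Type*} (A : Matrix ι ι ℂ) : Matrix ι ι ℂ :=
  (2 * Complex.I)⁻¹ • (A - A.conjTranspose)

/-- A real matrix, seen as a complex one. -/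
def toComplex {ι : Type*} (A : Matrix ι ι ℝ) : Matrix ι ι ℂ := A.map Complex.ofReal

/-- All the eigenvalues of all the matrices of the sequence lie in one bounded set. -/
def SpectrallyBounded {ι : ℕ → Type} [∀ m, Fintype (ι m)] [∀ m, DecidableEq (ι m)]
    (M : (m : ℕ) → Matrix (ι m) (ι m) ℂ) : Prop :=
  ∃ C : ℝ, ∀ m, ∀ z ∈ (M m).charpoly.roots, ‖z‖ ≤ C

open Classical in
/-- For every `ε > 0` the number of eigenvalues (with algebraic multiplicity) outside the open disk
of centre `p` and radius `ε` is bounded independently of the matrix of the sequence. -/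
def ProperlyClustered {ι : ℕ → Type} [∀ m, Fintype (ι m)] [∀ m, DecidableEq (ι m)]
    (M : (m : ℕ) → Matrix (ι m) (ι m) ℂ) (p : ℂ) : Prop :=
  ∀ ε : ℝ, 0 < ε → ∃ N : ℕ, ∀ m,
    ((M m).charpoly.roots.filter fun z => z ∉ Metric.ball p ε).card ≤ N

end

/-!
Put `Pₙ = D^{1/2} K D^{1/2}` with `K = Aₙ(1, 0)` the stiffness matrix of the Laplacian. The diffusion
matrix is symmetric, exactly as well as under quadrature, so `Im Aₙ = (Ψ - Ψᵀ) / 2i` comes from the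
convection matrix alone. Both matrices are compared with one quantity, the energy `|y|²` of the lattice
function `y = D^{1/2} g` extended by zero: the sum of the squares of its increments
(`latticeEnergy`).

* The form of `Pₙ` at `g` is the Dirichlet integral of the finite element function with nodal values
  `y`; evaluating it on every second triangle shows that it is at least a fixed multiple of `|y|²`
  (`latticeEnergy_le_form`).
* The scaled matrix `D^{-1/2} (Ψ - Ψᵀ) D^{-1/2}` is skew-symmetric, couples only neighbouring nodes and
  has entries `O(h)`. This uses only that `b` is bounded, that the error of quadrature is `O(h²)` and that
  `D` is bounded below uniformly (`exists_scaling_ge`). For such a stencil, skew-symmetry replaces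
  one value by an increment, so its form is at most `C h ‖y‖ |y|` (`norm_skew_stencil_le`).

Friedrichs' inequality `‖y‖ ≤ 2m |y|` (`sum_sq_le_latticeEnergy`) with `hm` constant bounds the form
of `Im Aₙ` by that of `Pₙ`, hence the spectrum. If the sums of `y` over the squares of about `m/r` by
`m/r` nodes vanish, the Poincaré inequality on each square
(`sum_sq_le_of_blockSums_eq_zero`) gives `‖y‖ ≤ C (m/r) |y|`, and the quotient of the two forms is
`O(1/r)`. These are `(2r)²` linear conditions, independently of `m`, so by the minimax principle for the
Hermitian pencil (`card_roots_inv_mul_le`) all but `2 (2r)²` eigenvalues are `O(1/r)`.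
-/

/-! ### Counting eigenvalues of Hermitian pencils -/

open Matrix in
/-- One half of the Courant–Fischer principle: on the span of the eigenvectors with eigenvalue at
least `ε` the quadratic form of `M` is at least `ε`, so this span meets `ker L` only in `0`. -/
theorem Matrix.IsHermitian.card_le_eigenvalues_le {n ι : Type*} [Fintype n] [DecidableEq n]
    [Fintype ι] {M : Matrix n n ℂ} (hM : M.IsHermitian) (L : (n → ℂ) →ₗ[ℂ] (ι → ℂ)) (ε : ℝ)
    (h : ∀ w, w ≠ 0 → L w = 0 → (star w ⬝ᵥ M *ᵥ w).re < ε * (star w ⬝ᵥ w).re) :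
    (Finset.univ.filter fun i => ε ≤ hM.eigenvalues i).card ≤ Fintype.card ι := by
  classical
  set s := Finset.univ.filter fun i => ε ≤ hM.eigenvalues i with hs
  set U : Matrix n n ℂ := hM.eigenvectorUnitary.1 with hU
  have hUU : star U * U = 1 := Unitary.coe_star_mul_self hM.eigenvectorUnitary
  have hspec : M = U * diagonal (fun i => (hM.eigenvalues i : ℂ)) * star U := by
    conv_lhs => rw [hM.spectral_theorem]
    rfl
  let ext : (s → ℂ) →ₗ[ℂ] (n → ℂ) :=
    { toFun := fun c i => if hi : i ∈ s then c ⟨i, hi⟩ else 0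
      map_add' := fun c d => by ext i; by_cases hi : i ∈ s <;> simp [hi]
      map_smul' := fun c d => by ext i; by_cases hi : i ∈ s <;> simp [hi] }
  have hinj : Function.Injective (L ∘ₗ U.mulVecLin ∘ₗ ext) := by
    rw [← LinearMap.ker_eq_bot, LinearMap.ker_eq_bot']
    intro c hc
    by_contra hc0
    set x := ext c with hx
    have hx0 : x ≠ 0 := by
      obtain ⟨i, hi⟩ := Function.ne_iff.mp hc0
      intro h0
      apply hi
      have := congrFun h0 i.1
      simpa [hx, ext] using this
    have hUx : star U *ᵥ (U *ᵥ x) = x := by rw [mulVec_mulVec, hUU, one_mulVec]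
    have hw0 : U *ᵥ x ≠ 0 := by
      intro h0
      rw [h0, mulVec_zero] at hUx
      exact hx0 hUx.symm
    have key := h (U *ᵥ x) hw0 hc
    have e1 : ∀ y : n → ℂ, star (U *ᵥ x) ⬝ᵥ (U *ᵥ y) = star x ⬝ᵥ y := by
      intro y
      rw [star_mulVec, ← dotProduct_mulVec, mulVec_mulVec, ← star_eq_conjTranspose, hUU, one_mulVec]
    rw [e1, hspec, ← mulVec_mulVec, hUx, ← mulVec_mulVec, e1] at key
    refine absurd key (not_lt.mpr ?_)
    simp only [dotProduct, mulVec_diagonal, Complex.re_sum, Finset.mul_sum, Pi.star_apply]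
    refine Finset.sum_le_sum fun i _ => ?_
    have e2 : (star (x i) * ((hM.eigenvalues i : ℂ) * x i)).re
        = hM.eigenvalues i * (star (x i) * x i).re := by
      rw [mul_left_comm, Complex.re_ofReal_mul]
    have e3 : 0 ≤ (star (x i) * x i).re := by
      simp only [RCLike.star_def, ← Complex.normSq_eq_conj_mul_self, Complex.ofReal_re]
      exact Complex.normSq_nonneg _
    rw [e2]
    by_cases hi : i ∈ s
    · exact mul_le_mul_of_nonneg_right (by simpa [hs] using hi) e3
    · have : x i = 0 := by simp [hx, ext, hi]
      simp [this]
  simpa using card_le_of_injective ℂ _ hinj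

/-- If the form of the Hermitian matrix `M` is below `ε` in absolute value under `#ι` linear
conditions `L`, then `M` has at most `2 · #ι` eigenvalues outside the disk of radius `ε`: at most `#ι`
on either side. -/
theorem Matrix.IsHermitian.card_roots_le {n ι : Type*} [Fintype n] [DecidableEq n] [Fintype ι]
    {M : Matrix n n ℂ} (hM : M.IsHermitian) (L : (n → ℂ) →ₗ[ℂ] (ι → ℂ)) {ε : ℝ}
    (h : ∀ w, w ≠ 0 → L w = 0 →
      |(star w ⬝ᵥ M.mulVec w).re| < ε * (star w ⬝ᵥ w).re) (p : ℂ → Prop) [DecidablePred p]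
    (hp : ∀ z, p z → ε ≤ ‖z‖) :
    (M.charpoly.roots.filter p).card ≤ 2 * Fintype.card ι := by
  classical
  have h1 : ∀ w, w ≠ 0 → L w = 0 → (star w ⬝ᵥ M.mulVec w).re < ε * (star w ⬝ᵥ w).re :=
    fun w h0 hL => lt_of_le_of_lt (le_abs_self _) (h w h0 hL)
  have h2 : ∀ w, w ≠ 0 → L w = 0 → (star w ⬝ᵥ (-M).mulVec w).re < ε * (star w ⬝ᵥ w).re :=
    fun w h0 hL => by
      rw [Matrix.neg_mulVec, dotProduct_neg, Complex.neg_re]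
      exact lt_of_le_of_lt (neg_le_abs _) (h w h0 hL)
  have c1 := hM.card_le_eigenvalues_le L ε h1
  have c2 := hM.neg.card_le_eigenvalues_le L ε h2
  have roots : ∀ {A : Matrix n n ℂ} (hA : A.IsHermitian), A.charpoly.roots =
      Multiset.map (fun i => (hA.eigenvalues i : ℂ)) Finset.univ.val :=
    fun hA => hA.roots_charpoly_eq_eigenvalues
  have count : ∀ {A : Matrix n n ℂ} (hA : A.IsHermitian) (q : ℂ → Prop) [DecidablePred q],
      (A.charpoly.roots.filter q).card =
        (Finset.univ.filter fun i => q (hA.eigenvalues i)).card := by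
    intro A hA q _
    rw [roots hA, Multiset.filter_map, Multiset.card_map]
    rfl
  have neg_roots : (-M).charpoly.roots = M.charpoly.roots.map (fun z => -z) := by
    have hd : -M = hM.eigenvectorUnitary.1 *
        Matrix.diagonal (fun i => -(hM.eigenvalues i : ℂ)) * star hM.eigenvectorUnitary.1 := by
      have e : M = hM.eigenvectorUnitary.1 *
        Matrix.diagonal (fun i => (hM.eigenvalues i : ℂ)) * star hM.eigenvectorUnitary.1 := by
        conv_lhs => rw [hM.spectral_theorem]
        rfl
      conv_lhs => rw [e]
      rw [← Matrix.neg_mul, ← Matrix.mul_neg, Matrix.diagonal_neg]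
    rw [hd, Matrix.charpoly_mul_comm, ← mul_assoc,
      show star hM.eigenvectorUnitary.1 * hM.eigenvectorUnitary.1 = 1 from
        Unitary.coe_star_mul_self hM.eigenvectorUnitary, one_mul, Matrix.charpoly_diagonal, roots hM,
      Multiset.map_map, Polynomial.roots_prod _ _
        (Finset.prod_ne_zero_iff.mpr fun i _ => Polynomial.X_sub_C_ne_zero _)]
    simp [Multiset.bind_singleton]
  have c1' : (M.charpoly.roots.filter fun z => ε ≤ z.re).card ≤ Fintype.card ι := by
    rw [count hM]; simpa using c1
  have c2' : (M.charpoly.roots.filter fun z => ε ≤ -z.re).card ≤ Fintype.card ι := by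
    have := count hM.neg (fun z => ε ≤ z.re)
    simp only [Complex.ofReal_re] at this
    rw [← this, neg_roots, Multiset.filter_map, Multiset.card_map] at c2
    simpa using c2
  have hle : M.charpoly.roots.filter p ≤ (M.charpoly.roots.filter fun z => ε ≤ z.re) +
      (M.charpoly.roots.filter fun z => ε ≤ -z.re) := by
    refine le_trans ?_ (le_trans (Multiset.le_add_right _ _)
      (Multiset.filter_add_filter (fun z : ℂ => ε ≤ z.re) (fun z => ε ≤ -z.re)
        M.charpoly.roots).ge)
    refine Multiset.le_filter.mpr ⟨Multiset.filter_le _ _, fun z hz => ?_⟩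
    rw [Multiset.mem_filter, roots hM, Multiset.mem_map] at hz
    obtain ⟨⟨i, -, rfl⟩, hpz⟩ := hz
    have := hp _ hpz
    rw [Complex.norm_real, Real.norm_eq_abs, le_abs] at this
    simpa using this
  have := Multiset.card_le_card hle
  rw [Multiset.card_add] at this
  omega

open Matrix in
/-- The pencil version: `P⁻¹E` with `P = BᴴB` is similar to the Hermitian matrix `B⁻ᴴEB⁻¹`. -/
theorem card_roots_inv_mul_le {n ι : Type*} [Fintype n] [DecidableEq n] [Fintype ι]
    {P : Matrix n n ℝ} {E : Matrix n n ℂ} (hP : P.PosDef) (hE : E.IsHermitian)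
    (L : (n → ℂ) →ₗ[ℂ] (ι → ℂ)) {ε : ℝ}
    (h : ∀ w, w ≠ 0 → L w = 0 →
      |(star w ⬝ᵥ E *ᵥ w).re| < ε * (star w ⬝ᵥ toComplex P *ᵥ w).re)
    (p : ℂ → Prop) [DecidablePred p] (hp : ∀ z, p z → ε ≤ ‖z‖) :
    (((toComplex P)⁻¹ * E).charpoly.roots.filter p).card ≤ 2 * Fintype.card ι := by
  obtain ⟨B, hB, hPB⟩ : ∃ B : Matrix n n ℂ, IsUnit B ∧ toComplex P = Bᴴ * B := by
    open scoped MatrixOrder in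
    obtain ⟨B, hB, hPB⟩ := CStarAlgebra.isStrictlyPositive_iff_eq_star_mul_self.mp
      (Matrix.isStrictlyPositive_iff_posDef.mpr hP)
    refine ⟨toComplex B, hB.map (RingHom.mapMatrix Complex.ofRealHom), ?_⟩
    rw [hPB]
    ext i j
    simp [toComplex, Matrix.mul_apply, Matrix.star_eq_conjTranspose]
  have hdet : IsUnit B.det := (Matrix.isUnit_iff_isUnit_det B).mp hB
  have e : (toComplex P)⁻¹ * E = B⁻¹ * ((B⁻¹)ᴴ * E) := by
    rw [hPB, Matrix.mul_inv_rev, mul_assoc, Matrix.conjTranspose_nonsing_inv]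
  rw [e, Matrix.charpoly_mul_comm]
  have hM : ((B⁻¹)ᴴ * E * B⁻¹).IsHermitian := Matrix.isHermitian_conjTranspose_mul_mul _ hE
  refine hM.card_roots_le (L ∘ₗ (B⁻¹).mulVecLin) (fun w hw hL => ?_) p hp
  have hBw : B *ᵥ (B⁻¹ *ᵥ w) = w := by
    rw [mulVec_mulVec, Matrix.mul_nonsing_inv _ hdet, one_mulVec]
  have h0 : B⁻¹ *ᵥ w ≠ 0 := by
    intro h0
    rw [h0, mulVec_zero] at hBw
    exact hw hBw.symm
  have key := h _ h0 hL
  rw [hPB, ← mulVec_mulVec, dotProduct_mulVec _ Bᴴ, ← star_mulVec, hBw] at key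
  rwa [← mulVec_mulVec, ← mulVec_mulVec, dotProduct_mulVec, ← star_mulVec]

noncomputable section

/-! ### Discrete Poincaré inequalities on the lattice -/

/-- The energy density of a lattice function: its squared increments in two lattice directions. -/
def latticeDensity (f : ℤ × ℤ → ℂ) (p : ℤ × ℤ) : ℝ :=
  ‖f (p + (1, 0)) - f p‖ ^ 2 + ‖f (p + (0, 1)) - f p‖ ^ 2

/-- The Dirichlet energy of a lattice function. The increments in the third direction `(1, -1)` of
the triangular lattice are left out, since they are controlled by the other two. -/
def latticeEnergy (f : ℤ × ℤ → ℂ) : ℝ := ∑' p, latticeDensity f p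

/-- The extension by zero of a vector of nodal values to the whole lattice. -/
def zeroExtend {m : ℕ} (y : Node m → ℂ) (p : ℤ × ℤ) : ℂ :=
  if h : p ∈ internalNodes m then y ⟨p, h⟩ else 0

theorem latticeDensity_nonneg (f : ℤ × ℤ → ℂ) (p : ℤ × ℤ) : 0 ≤ latticeDensity f p := by
  unfold latticeDensity; positivity

theorem zeroExtend_node {m : ℕ} (y : Node m → ℂ) (i : Node m) : zeroExtend y i = y i := by
  simp [zeroExtend]

theorem zeroExtend_of_notMem {m : ℕ} (y : Node m → ℂ) {p : ℤ × ℤ} (h : p ∉ internalNodes m) :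
    zeroExtend y p = 0 := by
  simp [zeroExtend, h]

theorem finite_support_zeroExtend {m : ℕ} (y : Node m → ℂ) : (zeroExtend y).support.Finite := by
  refine (internalNodes m).finite_toSet.subset fun p hp => ?_
  by_contra h
  exact hp (zeroExtend_of_notMem y h)

theorem mem_internalNodes {m : ℕ} {p : ℤ × ℤ} :
    p ∈ internalNodes m ↔ |p.1| < m ∧ |p.2| < m ∧ |p.1 + p.2| < m := by
  simp only [internalNodes, Finset.mem_filter, Finset.mem_product, Finset.mem_Icc, abs_lt]
  constructor
  · exact fun h => h.2
  · intro h
    refine ⟨?_, h⟩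
    omega

theorem sum_norm_sq_eq {m : ℕ} (y : Node m → ℂ) :
    ∑ i, ‖y i‖ ^ 2 = ∑ p ∈ internalNodes m, ‖zeroExtend y p‖ ^ 2 := by
  rw [← Finset.sum_coe_sort (internalNodes m) fun p => ‖zeroExtend y p‖ ^ 2]
  simp only [zeroExtend_node]

theorem summable_increment {f : ℤ × ℤ → ℂ} (hf : f.support.Finite) (d : ℤ × ℤ) :
    Summable fun p => ‖f (p + d) - f p‖ ^ 2 := by
  apply summable_of_hasFiniteSupport
  have h1 : ((fun p => p + d) ⁻¹' f.support).Finite :=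
    hf.preimage (add_left_injective d).injOn
  refine (h1.union hf).subset fun p hp => ?_
  by_contra h
  simp only [Set.mem_union, Set.mem_preimage, Function.mem_support, not_or, not_not] at h
  apply hp
  simp [h.1, h.2]

theorem summable_latticeDensity {f : ℤ × ℤ → ℂ} (hf : f.support.Finite) :
    Summable (latticeDensity f) :=
  (summable_increment hf (1, 0)).add (summable_increment hf (0, 1))

theorem latticeEnergy_nonneg (f : ℤ × ℤ → ℂ) : 0 ≤ latticeEnergy f :=
  tsum_nonneg (latticeDensity_nonneg f)

theorem sum_latticeDensity_le {f : ℤ × ℤ → ℂ} (hf : f.support.Finite) (s : Finset (ℤ × ℤ)) :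
    ∑ p ∈ s, latticeDensity f p ≤ latticeEnergy f :=
  (summable_latticeDensity hf).sum_le_tsum s fun p _ => latticeDensity_nonneg f p

theorem tsum_increment_neg (f : ℤ × ℤ → ℂ) (d : ℤ × ℤ) :
    ∑' p, ‖f (p + -d) - f p‖ ^ 2 = ∑' p, ‖f (p + d) - f p‖ ^ 2 := by
  rw [← (Equiv.addRight d).tsum_eq fun p => ‖f (p + -d) - f p‖ ^ 2]
  refine tsum_congr fun p => ?_
  rw [Equiv.coe_addRight, add_neg_cancel_right, norm_sub_rev]

theorem summable_increment_shift {f : ℤ × ℤ → ℂ} (hf : f.support.Finite) (c d : ℤ × ℤ) :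
    Summable fun p => ‖f (p + c + d) - f (p + c)‖ ^ 2 :=
  (summable_increment hf d).comp_injective (add_left_injective c)

theorem tsum_increment_shift (f : ℤ × ℤ → ℂ) (c d : ℤ × ℤ) :
    ∑' p, ‖f (p + c + d) - f (p + c)‖ ^ 2 = ∑' p, ‖f (p + d) - f p‖ ^ 2 :=
  (Equiv.addRight c).tsum_eq fun p => ‖f (p + d) - f p‖ ^ 2

/-- The six directions of the edges of the triangular lattice. -/
def latticeDirections : Finset (ℤ × ℤ) :=
  {(1, 0), -(1, 0), (0, 1), -(0, 1), (1, -1), -(1, -1)}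

theorem tsum_increment_le {f : ℤ × ℤ → ℂ} (hf : f.support.Finite) {d : ℤ × ℤ}
    (hd : d ∈ latticeDirections) : ∑' p, ‖f (p + d) - f p‖ ^ 2 ≤ 4 * latticeEnergy f := by
  have h0 := latticeEnergy_nonneg f
  have h1 : ∑' p, ‖f (p + (1, 0)) - f p‖ ^ 2 ≤ latticeEnergy f := by
    refine (summable_increment hf (1, 0)).tsum_le_tsum (fun p => ?_) (summable_latticeDensity hf)
    exact le_add_of_nonneg_right (sq_nonneg ‖f (p + (0, 1)) - f p‖)
  have h2 : ∑' p, ‖f (p + (0, 1)) - f p‖ ^ 2 ≤ latticeEnergy f := by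
    refine (summable_increment hf (0, 1)).tsum_le_tsum (fun p => ?_) (summable_latticeDensity hf)
    exact le_add_of_nonneg_left (sq_nonneg ‖f (p + (1, 0)) - f p‖)
  have h3 : ∑' p, ‖f (p + (1, -1)) - f p‖ ^ 2 ≤ 4 * latticeEnergy f := by
    have hs : Summable fun p : ℤ × ℤ => ‖f (p + (1, -1) + (0, 1)) - f (p + (1, -1))‖ ^ 2 :=
      summable_increment_shift hf _ _
    have e : ∑' p : ℤ × ℤ, ‖f (p + (1, -1) + (0, 1)) - f (p + (1, -1))‖ ^ 2 =
        ∑' p, ‖f (p + (0, 1)) - f p‖ ^ 2 := tsum_increment_shift f _ _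
    calc ∑' p, ‖f (p + (1, -1)) - f p‖ ^ 2
        ≤ ∑' p, (2 * ‖f (p + (1, 0)) - f p‖ ^ 2 +
            2 * ‖f (p + (1, -1) + (0, 1)) - f (p + (1, -1))‖ ^ 2) := by
          refine (summable_increment hf _).tsum_le_tsum (fun p => ?_)
            (((summable_increment hf _).mul_left 2).add (hs.mul_left 2))
          have e1 : p + (1, -1) + (0, 1) = p + (1, 0) := by
            rw [add_assoc]; rfl
          rw [e1]
          have := norm_sub_le (f (p + (1, 0)) - f p) (f (p + (1, 0)) - f (p + (1, -1)))
          rw [sub_sub_sub_cancel_left] at this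
          nlinarith [norm_nonneg (f (p + (1, -1)) - f p),
            sq_nonneg (‖f (p + (1, 0)) - f p‖ - ‖f (p + (1, 0)) - f (p + (1, -1))‖)]
      _ ≤ 4 * latticeEnergy f := by
          rw [((summable_increment hf _).mul_left 2).tsum_add (hs.mul_left 2), tsum_mul_left,
            tsum_mul_left, e]
          linarith
  simp only [latticeDirections, Finset.mem_insert, Finset.mem_singleton] at hd
  rcases hd with rfl | rfl | rfl | rfl | rfl | rfl <;> (try rw [tsum_increment_neg]) <;> linarith

/-- A function on an interval of `k` integers oscillates by at most its total variation. -/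
theorem norm_sub_sq_le_mul_sum (u : ℕ → ℂ) {k i j : ℕ} (hi : i < k) (hj : j < k) :
    ‖u i - u j‖ ^ 2 ≤ k * ∑ s ∈ Finset.range k, ‖u (s + 1) - u s‖ ^ 2 := by
  wlog hij : j ≤ i generalizing i j
  · rw [norm_sub_rev]
    exact this hj hi (by omega)
  have h1 : u i - u j = ∑ s ∈ Finset.Ico j i, (u (s + 1) - u s) :=
    (Finset.sum_Ico_sub u hij).symm
  have h2 : ‖u i - u j‖ ≤ ∑ s ∈ Finset.range k, ‖u (s + 1) - u s‖ := by
    rw [h1]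
    refine (norm_sum_le _ _).trans
      (Finset.sum_le_sum_of_subset_of_nonneg ?_ fun _ _ _ => norm_nonneg _)
    intro s hs
    simp only [Finset.mem_Ico, Finset.mem_range] at hs ⊢
    omega
  calc ‖u i - u j‖ ^ 2 ≤ (∑ s ∈ Finset.range k, ‖u (s + 1) - u s‖) ^ 2 := by gcongr
    _ ≤ _ := by simpa using sq_sum_le_card_mul_sum_sq (s := Finset.range k)
                  (f := fun s => ‖u (s + 1) - u s‖)

/-- The Poincaré inequality on a square of `k × k` lattice points, for functions of mean zero. -/
theorem sum_block_sq_le (u : ℕ → ℕ → ℂ) (k : ℕ)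
    (hu : ∑ i ∈ Finset.range k, ∑ j ∈ Finset.range k, u i j = 0) :
    ∑ i ∈ Finset.range k, ∑ j ∈ Finset.range k, ‖u i j‖ ^ 2 ≤
      2 * (k : ℝ) ^ 2 * ∑ i ∈ Finset.range k, ∑ j ∈ Finset.range k,
        (‖u (i + 1) j - u i j‖ ^ 2 + ‖u i (j + 1) - u i j‖ ^ 2) := by
  rcases Nat.eq_zero_or_pos k with rfl | hk
  · simp
  have hk' : (0 : ℝ) < k := by exact_mod_cast hk
  set R := Finset.range k with hR
  have hRc : (R.card : ℝ) = k := by simp [hR]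
  set X : ℕ → ℝ := fun b => ∑ s ∈ R, ‖u (s + 1) b - u s b‖ ^ 2 with hX
  set Y : ℕ → ℝ := fun c => ∑ t ∈ R, ‖u c (t + 1) - u c t‖ ^ 2 with hY
  -- Walk from `(i, j)` to `(c, d)` first along a row and then along a column.
  have pair : ∀ i ∈ R, ∀ j ∈ R, ∀ c ∈ R, ∀ d ∈ R,
      ‖u i j - u c d‖ ^ 2 ≤ 2 * (k * X j) + 2 * (k * Y c) := by
    intro i hi j hj c hc d hd
    have h1 := norm_sub_sq_le_mul_sum (fun s => u s j) (Finset.mem_range.mp hi)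
      (Finset.mem_range.mp hc)
    have h2 := norm_sub_sq_le_mul_sum (fun t => u c t) (Finset.mem_range.mp hj)
      (Finset.mem_range.mp hd)
    have h3 : ‖u i j - u c d‖ ≤ ‖u i j - u c j‖ + ‖u c j - u c d‖ :=
      norm_sub_le_norm_sub_add_norm_sub _ _ _
    have h4 : ‖u i j - u c d‖ ^ 2 ≤ 2 * ‖u i j - u c j‖ ^ 2 + 2 * ‖u c j - u c d‖ ^ 2 := by
      nlinarith [norm_nonneg (u i j - u c d), sq_nonneg (‖u i j - u c j‖ - ‖u c j - u c d‖)]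
    linarith
  have point : ∀ i ∈ R, ∀ j ∈ R, (k : ℝ) ^ 2 * ‖u i j‖ ^ 2 ≤
      2 * k ^ 3 * X j + 2 * k ^ 2 * ∑ c ∈ R, Y c := by
    intro i hi j hj
    have e : ((k : ℂ) ^ 2) * u i j = ∑ c ∈ R, ∑ d ∈ R, (u i j - u c d) := by
      simp only [Finset.sum_sub_distrib, hu, Finset.sum_const, nsmul_eq_mul]
      simp only [hR, Finset.card_range]
      ring
    have e2 : (k : ℝ) ^ 2 * ‖u i j‖ ≤ ∑ c ∈ R ×ˢ R, ‖u i j - u c.1 c.2‖ := by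
      calc (k : ℝ) ^ 2 * ‖u i j‖ = ‖((k : ℂ) ^ 2) * u i j‖ := by simp
        _ ≤ _ := by
          rw [e, ← Finset.sum_product' R R fun c d => u i j - u c d]
          exact norm_sum_le _ _
    have e3 : ((k : ℝ) ^ 2 * ‖u i j‖) ^ 2 ≤ k ^ 2 * ∑ c ∈ R ×ˢ R, ‖u i j - u c.1 c.2‖ ^ 2 := by
      calc ((k : ℝ) ^ 2 * ‖u i j‖) ^ 2 ≤ (∑ c ∈ R ×ˢ R, ‖u i j - u c.1 c.2‖) ^ 2 := by gcongr
        _ ≤ _ := by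
          have := sq_sum_le_card_mul_sum_sq (s := R ×ˢ R) (f := fun c => ‖u i j - u c.1 c.2‖)
          rw [Finset.card_product, Nat.cast_mul, hRc, ← sq] at this
          exact this
    have e4 : ∑ c ∈ R ×ˢ R, ‖u i j - u c.1 c.2‖ ^ 2 ≤
        2 * k ^ 3 * X j + 2 * k ^ 2 * ∑ c ∈ R, Y c := by
      calc ∑ c ∈ R ×ˢ R, ‖u i j - u c.1 c.2‖ ^ 2
          ≤ ∑ c ∈ R ×ˢ R, (2 * (k * X j) + 2 * (k * Y c.1)) :=
            Finset.sum_le_sum fun c hc => pair i hi j hj c.1 (Finset.mem_product.mp hc).1 c.2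
              (Finset.mem_product.mp hc).2
        _ = _ := by
            rw [Finset.sum_product]
            simp only [Finset.sum_const, nsmul_eq_mul, Finset.sum_add_distrib, ← Finset.mul_sum, hRc]
            ring
    have e5 : (k : ℝ) ^ 2 * (k ^ 2 * ‖u i j‖ ^ 2) ≤
        k ^ 2 * (2 * k ^ 3 * X j + 2 * k ^ 2 * ∑ c ∈ R, Y c) := by
      calc (k : ℝ) ^ 2 * (k ^ 2 * ‖u i j‖ ^ 2) = ((k : ℝ) ^ 2 * ‖u i j‖) ^ 2 := by ring
        _ ≤ _ := e3.trans (by gcongr)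
    exact le_of_mul_le_mul_left e5 (by positivity)
  have total : (k : ℝ) ^ 2 * ∑ i ∈ R, ∑ j ∈ R, ‖u i j‖ ^ 2 ≤
      k ^ 2 * (2 * k ^ 2 * (∑ j ∈ R, X j + ∑ c ∈ R, Y c)) := by
    calc (k : ℝ) ^ 2 * ∑ i ∈ R, ∑ j ∈ R, ‖u i j‖ ^ 2
        = ∑ i ∈ R, ∑ j ∈ R, (k : ℝ) ^ 2 * ‖u i j‖ ^ 2 := by simp only [Finset.mul_sum]
      _ ≤ ∑ i ∈ R, ∑ j ∈ R, (2 * k ^ 3 * X j + 2 * k ^ 2 * ∑ c ∈ R, Y c) :=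
          Finset.sum_le_sum fun i hi => Finset.sum_le_sum fun j hj => point i hi j hj
      _ = _ := by
          simp only [Finset.sum_const, nsmul_eq_mul, Finset.sum_add_distrib, ← Finset.mul_sum, hRc]
          ring
  have := le_of_mul_le_mul_left total (by positivity)
  rw [show ∑ j ∈ R, X j = ∑ i ∈ R, ∑ j ∈ R, ‖u (i + 1) j - u i j‖ ^ 2 from Finset.sum_comm] at this
  simpa only [hY, Finset.sum_add_distrib] using this

/-- Friedrichs' inequality: every row starts outside the hexagon, where the function vanishes. -/
theorem sum_sq_le_latticeEnergy {m : ℕ} (y : Node m → ℂ) :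
    ∑ i, ‖y i‖ ^ 2 ≤ (2 * (m : ℝ)) ^ 2 * latticeEnergy (zeroExtend y) := by
  set f := zeroExtend y with hf
  have hfin : f.support.Finite := finite_support_zeroExtend y
  set R := Finset.range (2 * m) with hR
  set W : ℤ → ℝ := fun b => ∑ s ∈ R, latticeDensity f (-(m : ℤ) + s, b) with hW
  have hinj : Set.InjOn (fun q : ℕ × ℕ => ((-(m : ℤ) + q.1, -(m : ℤ) + q.2) : ℤ × ℤ))
      ((R ×ˢ R : Finset (ℕ × ℕ)) : Set (ℕ × ℕ)) := by
    rintro ⟨i, j⟩ - ⟨i', j'⟩ - h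
    simp only [Prod.mk.injEq] at h ⊢
    omega
  have hsub : internalNodes m ⊆
      (R ×ˢ R).image fun q : ℕ × ℕ => ((-(m : ℤ) + q.1, -(m : ℤ) + q.2) : ℤ × ℤ) := by
    rintro ⟨p1, p2⟩ hp
    have h := mem_internalNodes.mp hp
    simp only [abs_lt] at h
    simp only [Finset.mem_image, Finset.mem_product, hR, Finset.mem_range, Prod.mk.injEq]
    exact ⟨((p1 + m).toNat, (p2 + m).toNat), by omega⟩
  have row : ∀ i ∈ R, ∀ b : ℤ, ‖f (-(m : ℤ) + i, b)‖ ^ 2 ≤ (2 * m : ℕ) * W b := by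
    intro i hi b
    have hi' := Finset.mem_range.mp hi
    have h := norm_sub_sq_le_mul_sum (fun s : ℕ => f (-(m : ℤ) + s, b)) hi'
      (show 0 < 2 * m by omega)
    have h0 : f (-(m : ℤ) + (0 : ℕ), b) = 0 := by
      apply zeroExtend_of_notMem
      rw [mem_internalNodes]
      simp
    simp only [h0, sub_zero] at h
    refine h.trans (mul_le_mul_of_nonneg_left (Finset.sum_le_sum fun s _ => ?_) (by positivity))
    refine le_trans (le_of_eq ?_) (le_add_of_nonneg_right (by positivity))
    simp [add_assoc]
  calc ∑ i, ‖y i‖ ^ 2 = ∑ p ∈ internalNodes m, ‖f p‖ ^ 2 := sum_norm_sq_eq y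
    _ ≤ ∑ p ∈ (R ×ˢ R).image fun q : ℕ × ℕ => ((-(m : ℤ) + q.1, -(m : ℤ) + q.2) : ℤ × ℤ),
          ‖f p‖ ^ 2 := Finset.sum_le_sum_of_subset_of_nonneg hsub fun _ _ _ => by positivity
    _ = ∑ q ∈ R ×ˢ R, ‖f (-(m : ℤ) + q.1, -(m : ℤ) + q.2)‖ ^ 2 := Finset.sum_image hinj
    _ ≤ ∑ q ∈ R ×ˢ R, ((2 * m : ℕ) * W (-(m : ℤ) + q.2)) :=
        Finset.sum_le_sum fun q hq => row q.1 (Finset.mem_product.mp hq).1 _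
    _ = (2 * (m : ℝ)) ^ 2 * ∑ q ∈ R ×ˢ R, latticeDensity f (-(m : ℤ) + q.1, -(m : ℤ) + q.2) := by
        rw [Finset.sum_product, Finset.sum_product, Finset.sum_comm (s := R) (t := R)
          (f := fun s j : ℕ => latticeDensity f (-(m : ℤ) + s, -(m : ℤ) + j))]
        simp only [Finset.sum_const, nsmul_eq_mul, ← Finset.mul_sum, hR, Finset.card_range, hW]
        push_cast
        ring
    _ = (2 * (m : ℝ)) ^ 2 * ∑ p ∈ (R ×ˢ R).image fun q : ℕ × ℕ =>
          ((-(m : ℤ) + q.1, -(m : ℤ) + q.2) : ℤ × ℤ), latticeDensity f p := by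
        rw [Finset.sum_image hinj]
    _ ≤ _ := mul_le_mul_of_nonneg_left (sum_latticeDensity_le hfin _) (by positivity)

/-- The indices of the `(2r)²` lattice squares that cover the hexagon. -/
abbrev BlockIndex (r : ℕ) : Type := ↥(Finset.Ico (-(r : ℤ)) r ×ˢ Finset.Ico (-(r : ℤ)) r)

/-- The sums of the values of a vector over the lattice squares of `k × k` points; the square with
index `A` has its lower corner at `k • A`. -/
def blockSums (m k r : ℕ) : (Node m → ℂ) →ₗ[ℂ] (BlockIndex r → ℂ) where
  toFun y A := ∑ i ∈ Finset.range k, ∑ j ∈ Finset.range k,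
    zeroExtend y (A.1.1 * k + i, A.1.2 * k + j)
  map_add' y z := by
    ext A
    simp only [Pi.add_apply, ← Finset.sum_add_distrib]
    refine Finset.sum_congr rfl fun i _ => Finset.sum_congr rfl fun j _ => ?_
    unfold zeroExtend
    split_ifs <;> simp
  map_smul' c y := by
    ext A
    simp only [Pi.smul_apply, RingHom.id_apply, Finset.smul_sum]
    refine Finset.sum_congr rfl fun i _ => Finset.sum_congr rfl fun j _ => ?_
    unfold zeroExtend
    split_ifs <;> simp

/-- The Poincaré inequality for functions whose sum over each lattice square vanishes. -/
theorem sum_sq_le_of_blockSums_eq_zero {m k r : ℕ} (hk : 0 < k) (hkr : m ≤ r * k)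
    {y : Node m → ℂ} (hy : blockSums m k r y = 0) :
    ∑ i, ‖y i‖ ^ 2 ≤ 2 * (k : ℝ) ^ 2 * latticeEnergy (zeroExtend y) := by
  set f := zeroExtend y with hf
  have hfin : f.support.Finite := finite_support_zeroExtend y
  have hkz : (0 : ℤ) < k := by exact_mod_cast hk
  set R := Finset.range k with hR
  set Bl := Finset.Ico (-(r : ℤ)) r ×ˢ Finset.Ico (-(r : ℤ)) r with hBl
  set Φ : (ℤ × ℤ) × (ℕ × ℕ) → ℤ × ℤ := fun q => (q.1.1 * k + q.2.1, q.1.2 * k + q.2.2) with hΦ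
  have divmod : ∀ (a : ℤ) (i : ℕ), i < k → (a * k + i) / k = a ∧ (a * k + i) % k = i := by
    intro a i hi
    have hi0 : (0 : ℤ) ≤ i := by positivity
    have hi1 : (i : ℤ) < k := by exact_mod_cast hi
    constructor
    · rw [add_comm, Int.add_mul_ediv_right _ _ hkz.ne', Int.ediv_eq_zero_of_lt hi0 hi1, zero_add]
    · rw [add_comm, Int.add_mul_emod_self_right, Int.emod_eq_of_lt hi0 hi1]
  have hinj : Set.InjOn Φ ((Bl ×ˢ (R ×ˢ R) : Finset _) : Set ((ℤ × ℤ) × (ℕ × ℕ))) := by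
    rintro ⟨⟨a, b⟩, i, j⟩ h ⟨⟨a', b'⟩, i', j'⟩ h' e
    simp only [Finset.coe_product, Set.mem_prod, Finset.mem_coe, hR, Finset.mem_range] at h h'
    simp only [hΦ, Prod.mk.injEq] at e ⊢
    have d1 := divmod a i h.2.1
    have d2 := divmod a' i' h'.2.1
    have d3 := divmod b j h.2.2
    have d4 := divmod b' j' h'.2.2
    rw [e.1] at d1
    rw [e.2] at d3
    have e1 := d1.1.symm.trans d2.1
    have e2 := d1.2.symm.trans d2.2
    have e3 := d3.1.symm.trans d4.1
    have e4 := d3.2.symm.trans d4.2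
    exact ⟨⟨e1, e3⟩, by exact_mod_cast e2, by exact_mod_cast e4⟩
  have hsub : internalNodes m ⊆ (Bl ×ˢ (R ×ˢ R)).image Φ := by
    rintro ⟨p1, p2⟩ hp
    have h := mem_internalNodes.mp hp
    simp only [abs_lt] at h
    have hkr' : (m : ℤ) ≤ r * k := by exact_mod_cast hkr
    have key : ∀ p : ℤ, -(m : ℤ) < p → p < m → (-(r : ℤ) ≤ p / k ∧ p / k < r) ∧
        (p % k).toNat < k ∧ p / k * k + (p % k).toNat = p := by
      intro p h1 h2
      have n1 := Int.emod_nonneg p hkz.ne'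
      have n2 := Int.emod_lt_of_pos p hkz
      refine ⟨⟨(Int.le_ediv_iff_mul_le hkz).mpr (by linarith),
        (Int.ediv_lt_iff_lt_mul hkz).mpr (by linarith)⟩, by omega, ?_⟩
      rw [Int.toNat_of_nonneg n1]
      exact Int.ediv_mul_add_emod p k
    obtain ⟨k1, k2, k3⟩ := key p1 h.1.1 h.1.2
    obtain ⟨l1, l2, l3⟩ := key p2 h.2.1.1 h.2.1.2
    simp only [Finset.mem_image, Finset.mem_product, hR, Finset.mem_range, hBl, Finset.mem_Ico]
    exact ⟨((p1 / k, p2 / k), ((p1 % k).toNat, (p2 % k).toNat)), ⟨⟨k1, l1⟩, k2, l2⟩,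
      Prod.ext k3 l3⟩
  have block : ∀ A ∈ Bl, ∑ q ∈ R ×ˢ R, ‖f (Φ (A, q))‖ ^ 2 ≤
      2 * (k : ℝ) ^ 2 * ∑ q ∈ R ×ˢ R, latticeDensity f (Φ (A, q)) := by
    intro A hA
    have h := sum_block_sq_le (fun i j => f (A.1 * k + i, A.2 * k + j)) k (congrFun hy ⟨A, hA⟩)
    rw [Finset.sum_product, Finset.sum_product]
    refine h.trans (le_of_eq ?_)
    simp [latticeDensity, hΦ, add_assoc, hR]
  calc ∑ i, ‖y i‖ ^ 2 = ∑ p ∈ internalNodes m, ‖f p‖ ^ 2 := sum_norm_sq_eq y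
    _ ≤ ∑ p ∈ (Bl ×ˢ (R ×ˢ R)).image Φ, ‖f p‖ ^ 2 :=
        Finset.sum_le_sum_of_subset_of_nonneg hsub fun _ _ _ => by positivity
    _ = ∑ A ∈ Bl, ∑ q ∈ R ×ˢ R, ‖f (Φ (A, q))‖ ^ 2 := by
        rw [Finset.sum_image hinj, Finset.sum_product]
    _ ≤ ∑ A ∈ Bl, 2 * (k : ℝ) ^ 2 * ∑ q ∈ R ×ˢ R, latticeDensity f (Φ (A, q)) :=
        Finset.sum_le_sum block
    _ = 2 * (k : ℝ) ^ 2 * ∑ p ∈ (Bl ×ˢ (R ×ˢ R)).image Φ, latticeDensity f p := by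
        rw [← Finset.mul_sum, Finset.sum_image hinj, Finset.sum_product (s := Bl)]
    _ ≤ _ := mul_le_mul_of_nonneg_left (sum_latticeDensity_le hfin _) (by positivity)

/-! ### Skew-symmetric stencils -/

/-- Summation by parts: skew-symmetry turns the form of `R` into a sum of products of values with
increments. -/
theorem norm_skew_form_le {ι : Type*} [Fintype ι] (R : Matrix ι ι ℝ) (hR : ∀ i j, R j i = -R i j)
    (y : ι → ℂ) : ‖∑ i, ∑ j, star (y i) * (R i j * y j)‖ ≤
      ∑ i, ∑ j, |R i j| * (‖y i‖ * ‖y j - y i‖) := by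
  have h1 : 2 * ∑ i, ∑ j, star (y i) * (R i j * y j) =
      ∑ i, ∑ j, (R i j : ℂ) * (star (y i) * (y j - y i) - star (y j - y i) * y i) := by
    have e : ∑ i, ∑ j, star (y i) * (R i j * y j) = -∑ i, ∑ j, star (y j) * (R i j * y i) := by
      rw [Finset.sum_comm, ← Finset.sum_neg_distrib]
      refine Finset.sum_congr rfl fun i _ => ?_
      rw [← Finset.sum_neg_distrib]
      refine Finset.sum_congr rfl fun j _ => ?_
      rw [hR i j]
      push_cast
      ring
    rw [two_mul]
    nth_rewrite 2 [e]
    rw [← sub_eq_add_neg, ← Finset.sum_sub_distrib]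
    refine Finset.sum_congr rfl fun i _ => ?_
    rw [← Finset.sum_sub_distrib]
    refine Finset.sum_congr rfl fun j _ => ?_
    rw [star_sub]
    ring
  have h2 : ‖2 * ∑ i, ∑ j, star (y i) * (R i j * y j)‖ ≤
      2 * ∑ i, ∑ j, |R i j| * (‖y i‖ * ‖y j - y i‖) := by
    rw [h1, Finset.mul_sum]
    refine (norm_sum_le _ _).trans (Finset.sum_le_sum fun i _ => ?_)
    rw [Finset.mul_sum]
    refine (norm_sum_le _ _).trans (Finset.sum_le_sum fun j _ => ?_)
    rw [norm_mul, Complex.norm_real, Real.norm_eq_abs]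
    have : ‖star (y i) * (y j - y i) - star (y j - y i) * y i‖ ≤ 2 * (‖y i‖ * ‖y j - y i‖) := by
      refine (norm_sub_le _ _).trans (le_of_eq ?_)
      rw [norm_mul, norm_mul, norm_star, norm_star]
      ring
    calc |R i j| * _ ≤ |R i j| * (2 * (‖y i‖ * ‖y j - y i‖)) := by gcongr
      _ = _ := by ring
  rw [norm_mul, Complex.norm_ofNat] at h2
  linarith

/-- A skew-symmetric matrix with small entries, coupling only neighbouring nodes, has a form that
gains one derivative: it is bounded by the product of the norm and the root of the energy. -/
theorem norm_skew_stencil_le {m : ℕ} (R : Matrix (Node m) (Node m) ℝ)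
    (hR : ∀ i j, R j i = -R i j) {τ : ℝ} (hτ : ∀ i j, |R i j| ≤ τ)
    (hsparse : ∀ i j : Node m, i ≠ j → (j : ℤ × ℤ) - i ∉ latticeDirections → R i j = 0)
    (y : Node m → ℂ) : ‖∑ i, ∑ j, star (y i) * (R i j * y j)‖ ≤
      12 * τ * (√(∑ i, ‖y i‖ ^ 2) * √(latticeEnergy (zeroExtend y))) := by
  set f := zeroExtend y with hf
  have hfin : f.support.Finite := finite_support_zeroExtend y
  rcases isEmpty_or_nonempty (Node m) with hempty | ⟨⟨i₀⟩⟩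
  · simp
  have hτ0 : 0 ≤ τ := (abs_nonneg _).trans (hτ i₀ i₀)
  have hrow : ∀ i : Node m, ∑ j, |R i j| * (‖y i‖ * ‖y j - y i‖) ≤
      τ * ∑ d ∈ latticeDirections, ‖f i‖ * ‖f (i + d) - f i‖ := by
    intro i
    have hz : ∀ j ∉ Finset.univ.filter (fun j : Node m => (j : ℤ × ℤ) - i ∈ latticeDirections),
        |R i j| * (‖y i‖ * ‖y j - y i‖) = 0 := by
      intro j hj
      simp only [Finset.mem_filter, Finset.mem_univ, true_and] at hj
      rcases eq_or_ne i j with rfl | hij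
      · simp
      · rw [hsparse i j hij hj]; simp
    rw [← Finset.sum_subset (Finset.subset_univ _) fun j _ hj => hz j hj]
    calc ∑ j ∈ Finset.univ.filter (fun j : Node m => (j : ℤ × ℤ) - i ∈ latticeDirections),
          |R i j| * (‖y i‖ * ‖y j - y i‖)
        ≤ ∑ j ∈ Finset.univ.filter (fun j : Node m => (j : ℤ × ℤ) - i ∈ latticeDirections),
          τ * (‖f i‖ * ‖f (i + ((j : ℤ × ℤ) - i)) - f i‖) := by
          refine Finset.sum_le_sum fun j _ => ?_
          rw [add_sub_cancel, hf, zeroExtend_node, zeroExtend_node]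
          exact mul_le_mul_of_nonneg_right (hτ i j) (by positivity)
      _ = ∑ d ∈ (Finset.univ.filter
            (fun j : Node m => (j : ℤ × ℤ) - i ∈ latticeDirections)).image
              (fun j : Node m => (j : ℤ × ℤ) - i), τ * (‖f i‖ * ‖f (i + d) - f i‖) := by
          rw [Finset.sum_image]
          intro j _ j' _ h
          exact Subtype.ext (sub_left_injective h)
      _ ≤ ∑ d ∈ latticeDirections, τ * (‖f i‖ * ‖f (i + d) - f i‖) := by
          refine Finset.sum_le_sum_of_subset_of_nonneg ?_ fun _ _ _ => by positivity
          intro d hd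
          obtain ⟨j, hj, rfl⟩ := Finset.mem_image.mp hd
          exact (Finset.mem_filter.mp hj).2
      _ = _ := by rw [Finset.mul_sum]
  have hdir : ∀ d ∈ latticeDirections, ∑ i : Node m, ‖f i‖ * ‖f (i + d) - f i‖ ≤
      √(∑ i, ‖y i‖ ^ 2) * (2 * √(latticeEnergy f)) := by
    intro d hd
    refine (Real.sum_mul_le_sqrt_mul_sqrt _ _ _).trans ?_
    have e1 : ∑ i : Node m, ‖f i‖ ^ 2 = ∑ i, ‖y i‖ ^ 2 :=
      Finset.sum_congr rfl fun i _ => by rw [hf, zeroExtend_node]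
    have e2 : ∑ i : Node m, ‖f (i + d) - f i‖ ^ 2 ≤ 4 * latticeEnergy f := by
      refine le_trans ?_ (tsum_increment_le hfin hd)
      rw [Finset.sum_coe_sort (internalNodes m) fun p => ‖f (p + d) - f p‖ ^ 2]
      exact (summable_increment hfin d).sum_le_tsum _ fun _ _ => by positivity
    have e3 : √(4 * latticeEnergy f) = 2 * √(latticeEnergy f) := by
      rw [show (4 : ℝ) = 2 ^ 2 by norm_num, Real.sqrt_mul (by positivity),
        Real.sqrt_sq (by norm_num)]
    rw [e1, ← e3]
    gcongr
  calc ‖∑ i, ∑ j, star (y i) * (R i j * y j)‖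
      ≤ ∑ i, ∑ j, |R i j| * (‖y i‖ * ‖y j - y i‖) := norm_skew_form_le R hR y
    _ ≤ ∑ i : Node m, τ * ∑ d ∈ latticeDirections, ‖f i‖ * ‖f (i + d) - f i‖ :=
        Finset.sum_le_sum fun i _ => hrow i
    _ = τ * ∑ d ∈ latticeDirections, ∑ i : Node m, ‖f i‖ * ‖f (i + d) - f i‖ := by
        rw [← Finset.mul_sum, Finset.sum_comm]
    _ ≤ τ * ∑ d ∈ latticeDirections, √(∑ i, ‖y i‖ ^ 2) * (2 * √(latticeEnergy f)) := by
        gcongr with d hd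
        exact hdir d hd
    _ = _ := by
        rw [Finset.sum_const, show latticeDirections.card = 6 from rfl, nsmul_eq_mul]
        push_cast
        ring

end

noncomputable section

/-! ### Geometry of the hexagon and gradients of the basis functions -/

namespace RegularHexagon

variable (H : RegularHexagon)

/-- The constant gradient of the coordinate `coordU`. -/
def gradU : Plane := (3 * H.side ^ 2)⁻¹ • ((4 : ℝ) • H.u - (2 : ℝ) • H.v)

/-- The constant gradient of the coordinate `coordV`. -/
def gradV : Plane := (3 * H.side ^ 2)⁻¹ • ((4 : ℝ) • H.v - (2 : ℝ) • H.u)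

theorem inner_v_u : ⟪H.v, H.u⟫_ℝ = H.side ^ 2 / 2 := by
  rw [real_inner_comm]; exact H.inner_u_v

theorem norm_sq_smul_gradU_add_smul_gradV (α β : ℝ) :
    ‖α • H.gradU + β • H.gradV‖ ^ 2 = 4 / (3 * H.side ^ 2) * (α ^ 2 + β ^ 2 - α * β) := by
  have h0 := H.side_pos
  have huu : ⟪H.u, H.u⟫_ℝ = H.side ^ 2 := by rw [real_inner_self_eq_norm_sq, H.norm_u]
  have hvv : ⟪H.v, H.v⟫_ℝ = H.side ^ 2 := by rw [real_inner_self_eq_norm_sq, H.norm_v]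
  rw [← real_inner_self_eq_norm_sq]
  simp only [gradU, gradV, inner_add_left, inner_add_right, inner_sub_left, inner_sub_right,
    real_inner_smul_left, real_inner_smul_right, H.inner_u_v, H.inner_v_u, huu, hvv]
  field_simp
  ring

theorem norm_gradU_le : ‖H.gradU‖ ≤ 2 / H.side := by
  have h0 := H.side_pos
  have h := H.norm_sq_smul_gradU_add_smul_gradV 1 0
  simp only [one_smul, zero_smul, add_zero] at h
  refine abs_le_of_sq_le_sq' ?_ (by positivity) |>.2
  rw [h, div_pow, div_mul_eq_mul_div, div_le_div_iff₀ (by positivity) (by positivity)]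
  nlinarith [sq_nonneg H.side]

theorem norm_gradV_le : ‖H.gradV‖ ≤ 2 / H.side := by
  have h0 := H.side_pos
  have h := H.norm_sq_smul_gradU_add_smul_gradV 0 1
  simp only [one_smul, zero_smul, zero_add] at h
  refine abs_le_of_sq_le_sq' ?_ (by positivity) |>.2
  rw [h, div_pow, div_mul_eq_mul_div, div_le_div_iff₀ (by positivity) (by positivity)]
  nlinarith [sq_nonneg H.side]

theorem abs_coordU_sub_le (x y : Plane) :
    |H.coordU x - H.coordU y| ≤ 2 / H.side * ‖x - y‖ := by
  have e : H.coordU x - H.coordU y = ⟪H.gradU, x - y⟫_ℝ := by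
    rw [coordU_eq, coordU_eq, inner_sub_right]; unfold gradU; ring
  rw [e]
  exact (abs_real_inner_le_norm _ _).trans (by gcongr; exact H.norm_gradU_le)

theorem abs_coordV_sub_le (x y : Plane) :
    |H.coordV x - H.coordV y| ≤ 2 / H.side * ‖x - y‖ := by
  have e : H.coordV x - H.coordV y = ⟪H.gradV, x - y⟫_ℝ := by
    rw [coordV_eq, coordV_eq, inner_sub_right]; unfold gradV; ring
  rw [e]
  exact (abs_real_inner_le_norm _ _).trans (by gcongr; exact H.norm_gradV_le)

theorem continuous_coordU : Continuous H.coordU := by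
  unfold coordU; fun_prop

theorem continuous_coordV : Continuous H.coordV := by
  unfold coordV; fun_prop

theorem isOpen_domain : IsOpen H.domain := by
  have h1 := H.continuous_coordU
  have h2 := H.continuous_coordV
  exact (isOpen_lt h1.abs continuous_const).inter
    ((isOpen_lt h2.abs continuous_const).inter (isOpen_lt (h1.add h2).abs continuous_const))

theorem norm_sub_center_le (x : Plane) :
    ‖x - H.center‖ ≤ (|H.coordU x| + |H.coordV x|) * H.side := by
  have e : x - H.center = H.coordU x • H.u + H.coordV x • H.v := by
    conv_lhs => rw [H.eq_combination x]
    abel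
  rw [e]
  refine (norm_add_le _ _).trans (le_of_eq ?_)
  rw [norm_smul, norm_smul, H.norm_u, H.norm_v, Real.norm_eq_abs, Real.norm_eq_abs]
  ring

theorem isBounded_domain : Bornology.IsBounded H.domain := by
  refine Metric.isBounded_closedBall (x := H.center) (r := 2 * H.side) |>.subset fun x hx => ?_
  rw [mem_closedBall_iff_norm]
  refine (H.norm_sub_center_le x).trans ?_
  have := H.side_pos
  gcongr
  linarith [hx.1, hx.2.1]

theorem isCompact_closure_domain : IsCompact (closure H.domain) :=
  H.isBounded_domain.isCompact_closure

theorem volume_domain_lt_top : volume H.domain < ⊤ := H.isBounded_domain.measure_lt_top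

/-- The hexagonal cone that defines the basis functions is Lipschitz. -/
theorem abs_cone_sub_cone_le (A B A' B' : ℝ) :
    |max 0 (1 - max |A| (max |B| |A + B|)) - max 0 (1 - max |A'| (max |B'| |A' + B'|))| ≤
      |A - A'| + |B - B'| := by
  have h0 := abs_nonneg (A - A')
  have h1 := abs_nonneg (B - B')
  have hA := abs_abs_sub_abs_le A A'
  have hB := abs_abs_sub_abs_le B B'
  have hAB : |(|A + B|) - (|A' + B'|)| ≤ |A - A'| + |B - B'| := by
    refine (abs_abs_sub_abs_le _ _).trans ?_
    rw [add_sub_add_comm]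
    exact abs_add_le _ _
  refine (abs_max_sub_max_le_max _ _ _ _).trans (max_le (by simp; positivity) ?_)
  rw [sub_sub_sub_cancel_left, abs_sub_comm]
  refine (abs_max_sub_max_le_max _ _ _ _).trans (max_le (by linarith) ?_)
  exact (abs_max_sub_max_le_max _ _ _ _).trans (max_le (by linarith) hAB)

theorem lipschitzWith_hat (m : ℕ) (q : ℤ × ℤ) :
    LipschitzWith (Real.toNNReal (4 * m / H.side)) (H.hat m q) := by
  have h0 := H.side_pos
  refine LipschitzWith.of_dist_le_mul fun x y => ?_
  rw [Real.coe_toNNReal _ (by positivity), Real.dist_eq, dist_eq_norm]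
  refine (abs_cone_sub_cone_le _ _ _ _).trans ?_
  rw [sub_sub_sub_cancel_right, sub_sub_sub_cancel_right, ← mul_sub, ← mul_sub, abs_mul, abs_mul,
    Nat.abs_cast]
  have hU := mul_le_mul_of_nonneg_left (H.abs_coordU_sub_le x y) (Nat.cast_nonneg m)
  have hV := mul_le_mul_of_nonneg_left (H.abs_coordV_sub_le x y) (Nat.cast_nonneg m)
  calc _ ≤ _ := add_le_add hU hV
    _ = _ := by ring

/-- The bound holds at every point, since `gradient` is `0` where the basis function has a kink. -/
theorem norm_gradient_hat_le (m : ℕ) (q : ℤ × ℤ) (x : Plane) :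
    ‖gradient (H.hat m q) x‖ ≤ 4 * m / H.side := by
  have h0 := H.side_pos
  have h := norm_fderiv_le_of_lipschitz ℝ (H.lipschitzWith_hat m q) (x₀ := x)
  rw [Real.coe_toNNReal _ (by positivity)] at h
  rwa [gradient, LinearIsometryEquiv.norm_map]

theorem measurable_gradient_hat (m : ℕ) (q : ℤ × ℤ) : Measurable (gradient (H.hat m q)) :=
  (InnerProductSpace.toDual ℝ Plane).symm.continuous.measurable.comp (measurable_fderiv ℝ _)

theorem hat_nonneg (m : ℕ) (q : ℤ × ℤ) (x : Plane) : 0 ≤ H.hat m q x := le_max_left _ _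

theorem hat_le_one (m : ℕ) (q : ℤ × ℤ) (x : Plane) : H.hat m q x ≤ 1 := by
  refine max_le zero_le_one ?_
  have := (abs_nonneg (m * H.coordU x - q.1)).trans (le_max_left _ (max |m * H.coordV x - q.2|
    |(m * H.coordU x - q.1) + (m * H.coordV x - q.2)|))
  linarith

theorem abs_lt_of_hat_ne_zero {m : ℕ} {q : ℤ × ℤ} {x : Plane} (h : H.hat m q x ≠ 0) :
    |m * H.coordU x - q.1| < 1 ∧ |m * H.coordV x - q.2| < 1 ∧
      |(m * H.coordU x - q.1) + (m * H.coordV x - q.2)| < 1 := by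
  by_contra hc
  apply h
  apply max_eq_left
  rw [sub_nonpos]
  by_contra hlt
  rw [not_le, max_lt_iff, max_lt_iff] at hlt
  exact hc hlt

/-- Away from the closed support a basis function vanishes locally, so all its gradients vanish. -/
theorem abs_le_of_not_eventuallyEq_zero {m : ℕ} {q : ℤ × ℤ} {x : Plane}
    (h : ¬ H.hat m q =ᶠ[nhds x] fun _ => 0) :
    |m * H.coordU x - q.1| ≤ 1 ∧ |m * H.coordV x - q.2| ≤ 1 ∧
      |(m * H.coordU x - q.1) + (m * H.coordV x - q.2)| ≤ 1 := by
  by_contra hc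
  apply h
  have h1 := H.continuous_coordU
  have h2 := H.continuous_coordV
  have hopen : IsOpen {y | 1 < max |m * H.coordU y - q.1| (max |m * H.coordV y - q.2|
      |(m * H.coordU y - q.1) + (m * H.coordV y - q.2)|)} :=
    isOpen_lt continuous_const (by fun_prop)
  have hx : x ∈ {y | 1 < max |m * H.coordU y - q.1| (max |m * H.coordV y - q.2|
      |(m * H.coordU y - q.1) + (m * H.coordV y - q.2)|)} := by
    by_contra hlt
    rw [Set.mem_ofPred_eq, not_lt, max_le_iff, max_le_iff] at hlt
    exact hc hlt
  filter_upwards [hopen.mem_nhds hx] with y hy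
  exact max_eq_left (by rw [sub_nonpos]; exact le_of_lt hy)

theorem sub_mem_latticeDirections {m : ℕ} {i j : ℤ × ℤ} (hij : i ≠ j) {x : Plane}
    (hi : ¬ H.hat m i =ᶠ[nhds x] fun _ => 0) (hj : H.hat m j x ≠ 0) :
    j - i ∈ latticeDirections := by
  obtain ⟨a1, a2, a3⟩ := H.abs_le_of_not_eventuallyEq_zero hi
  obtain ⟨b1, b2, b3⟩ := H.abs_lt_of_hat_ne_zero hj
  obtain ⟨i1, i2⟩ := i
  obtain ⟨j1, j2⟩ := j
  simp only [abs_le, abs_lt] at a1 a2 a3 b1 b2 b3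
  have c1 : j1 - i1 < 2 := by
    have : (j1 - i1 : ℝ) < 2 := by linarith
    exact_mod_cast this
  have c2 : -2 < j1 - i1 := by
    have : (-2 : ℝ) < j1 - i1 := by linarith
    exact_mod_cast this
  have c3 : j2 - i2 < 2 := by
    have : (j2 - i2 : ℝ) < 2 := by linarith
    exact_mod_cast this
  have c4 : -2 < j2 - i2 := by
    have : (-2 : ℝ) < j2 - i2 := by linarith
    exact_mod_cast this
  have c5 : (j1 - i1) + (j2 - i2) < 2 := by
    have : (j1 - i1 : ℝ) + (j2 - i2) < 2 := by linarith
    exact_mod_cast this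
  have c6 : -2 < (j1 - i1) + (j2 - i2) := by
    have : (-2 : ℝ) < (j1 - i1) + (j2 - i2) := by linarith
    exact_mod_cast this
  have hne : ¬ (j1 - i1 = 0 ∧ j2 - i2 = 0) := by
    rintro ⟨h1, h2⟩
    exact hij (Prod.ext (by simp only; omega) (by simp only; omega))
  simp only [latticeDirections, Finset.mem_insert, Finset.mem_singleton, Prod.mk_sub_mk,
    Prod.neg_mk, Prod.mk.injEq]
  omega

theorem gradient_hat_eq_zero {m : ℕ} {q : ℤ × ℤ} {x : Plane}
    (h : H.hat m q =ᶠ[nhds x] fun _ => 0) : gradient (H.hat m q) x = 0 := by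
  rw [gradient, h.fderiv_eq, fderiv_const_apply, map_zero]

theorem gradientWithin_hat_eq_zero {m : ℕ} {q : ℤ × ℤ} {x : Plane}
    (h : H.hat m q =ᶠ[nhds x] fun _ => 0) (s : Set Plane) :
    gradientWithin (H.hat m q) s x = 0 := by
  rw [gradientWithin, (h.filter_mono nhdsWithin_le_nhds).fderivWithin_eq h.self_of_nhds,
    fderivWithin_const_apply, map_zero]

/-! ### Entries of the convection matrices -/

theorem convectionMatrix_sparse (b : Plane → Plane) {m : ℕ} {i j : Node m} (hij : i ≠ j)
    (h : (j : ℤ × ℤ) - i ∉ latticeDirections) : H.convectionMatrix b m i j = 0 := by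
  rw [convectionMatrix, Matrix.of_apply, neg_eq_zero]
  refine integral_eq_zero_of_ae (Filter.Eventually.of_forall fun x => ?_)
  by_cases hj : H.hat m j x = 0
  · simp [hj]
  · have hi : H.hat m i =ᶠ[nhds x] fun _ => 0 := by
      by_contra hi
      exact h (H.sub_mem_latticeDirections (fun e => hij (Subtype.ext e)) hi hj)
    simp [H.gradient_hat_eq_zero hi]

theorem quadConvectionMatrix_sparse (Q : H.QuadratureFamily) (b : Plane → Plane) {m : ℕ}
    {i j : Node m} (hij : i ≠ j) (h : (j : ℤ × ℤ) - i ∉ latticeDirections) :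
    H.quadConvectionMatrix Q b m i j = 0 := by
  rw [quadConvectionMatrix, Matrix.of_apply, neg_eq_zero]
  refine Finset.sum_eq_zero fun T _ => Finset.sum_eq_zero fun k _ => ?_
  set x := (Q m T).node k
  by_cases hj : H.hat m j x = 0
  · simp [hj]
  · have hi : H.hat m i =ᶠ[nhds x] fun _ => 0 := by
      by_contra hi
      exact h (H.sub_mem_latticeDirections (fun e => hij (Subtype.ext e)) hi hj)
    simp [H.gradientWithin_hat_eq_zero hi]

theorem support_hat_subset_ball {m : ℕ} (hm : 0 < m) (q : ℤ × ℤ) :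
    {x | H.hat m q x ≠ 0} ⊆ Metric.ball (H.meshPoint m q) (2 * H.side / m) := by
  intro x hx
  have h0 := H.side_pos
  have hm' : (0 : ℝ) < m := by exact_mod_cast hm
  obtain ⟨b1, b2, -⟩ := H.abs_lt_of_hat_ne_zero hx
  have e : x - H.meshPoint m q =
      ((m * H.coordU x - q.1) / m) • H.u + ((m * H.coordV x - q.2) / m) • H.v := by
    conv_lhs => rw [H.eq_combination x]
    rw [meshPoint, sub_div, sub_div, mul_div_cancel_left₀ _ hm'.ne', mul_div_cancel_left₀ _ hm'.ne',
      sub_smul, sub_smul]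
    abel
  rw [mem_ball_iff_norm, e]
  refine (norm_add_le _ _).trans_lt ?_
  rw [norm_smul, norm_smul, H.norm_u, H.norm_v, Real.norm_eq_abs, Real.norm_eq_abs, abs_div,
    abs_div, Nat.abs_cast, ← add_mul, ← add_div, mul_comm, mul_div_assoc', mul_comm]
  gcongr
  linarith

/-- The entries of the convection matrix are `O(h)`: the gradient is `O(1/h)` and the support has
area `O(h²)`. -/
theorem exists_abs_convectionMatrix_le {b : Plane → Plane}
    (hb : ContinuousOn b (closure H.domain)) :
    ∃ C : ℝ, 0 ≤ C ∧ ∀ m, ∀ i j : Node m, |H.convectionMatrix b m i j| ≤ C * H.meshSize m := by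
  obtain ⟨B, hB⟩ := H.isCompact_closure_domain.exists_bound_of_continuousOn hb
  have h0 := H.side_pos
  refine ⟨|B| * (16 * Real.pi), by positivity, fun m i j => ?_⟩
  have hm : 0 < m := by
    have := (mem_internalNodes.mp i.2).1
    exact_mod_cast (abs_nonneg _).trans_lt this
  have hm' : (0 : ℝ) < m := by exact_mod_cast hm
  set A := H.domain ∩ Metric.ball (H.meshPoint m j) (2 * H.side / m) with hA
  have hAm : MeasurableSet A := H.isOpen_domain.measurableSet.inter measurableSet_ball
  have hball : volume (Metric.ball (H.meshPoint m j) (2 * H.side / m)) =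
      ENNReal.ofReal ((2 * H.side / m) ^ 2 * Real.pi) := by
    rw [EuclideanSpace.volume_ball_fin_two, ENNReal.ofReal_mul (by positivity),
      ENNReal.ofReal_pow (by positivity)]
  have hAv : volume A ≤ ENNReal.ofReal ((2 * H.side / m) ^ 2 * Real.pi) :=
    (measure_mono Set.inter_subset_right).trans hball.le
  have hAr : volume.real A ≤ (2 * H.side / m) ^ 2 * Real.pi :=
    ENNReal.toReal_le_of_le_ofReal (by positivity) hAv
  rw [convectionMatrix, Matrix.of_apply, abs_neg,
    setIntegral_eq_of_subset_of_forall_sdiff_eq_zero (s := A) H.isOpen_domain.measurableSet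
      Set.inter_subset_left, ← Real.norm_eq_abs]
  · refine (norm_setIntegral_le_of_norm_le_const (C := |B| * (4 * m / H.side))
      (lt_of_le_of_lt hAv ENNReal.ofReal_lt_top) fun x hx => ?_).trans ?_
    · rw [norm_mul, Real.norm_eq_abs (H.hat m j x), abs_of_nonneg (H.hat_nonneg m j x)]
      have h1 : ‖⟪b x, gradient (H.hat m i) x⟫_ℝ‖ ≤ |B| * (4 * m / H.side) :=
        (norm_inner_le_norm _ _).trans (mul_le_mul
          ((hB x (subset_closure hx.1)).trans (le_abs_self B)) (H.norm_gradient_hat_le m i x)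
          (norm_nonneg _) (abs_nonneg _))
      calc _ ≤ |B| * (4 * m / H.side) * 1 := mul_le_mul h1 (H.hat_le_one m j x)
              (H.hat_nonneg m j x) (by positivity)
        _ = _ := mul_one _
    · calc _ ≤ |B| * (4 * m / H.side) * ((2 * H.side / m) ^ 2 * Real.pi) := by gcongr
        _ = _ := by
          rw [meshSize]
          field_simp
          ring
  · intro x hx
    have : H.hat m j x = 0 := by
      by_contra hne
      exact hx.2 ⟨hx.1, H.support_hat_subset_ball hm j hne⟩
    simp [this]

/-! ### The energy of the diffusion matrix -/

theorem integrableOn_diffusion {a : Plane → ℝ} (ha : ContinuousOn a (closure H.domain)) (m : ℕ)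
    (p q : ℤ × ℤ) : IntegrableOn
      (fun x => a x * ⟪gradient (H.hat m p) x, gradient (H.hat m q) x⟫_ℝ) H.domain := by
  obtain ⟨A, hA⟩ := H.isCompact_closure_domain.exists_bound_of_continuousOn ha
  have hmeas : AEStronglyMeasurable
      (fun x => a x * ⟪gradient (H.hat m p) x, gradient (H.hat m q) x⟫_ℝ)
      (volume.restrict H.domain) :=
    ((ha.mono subset_closure).aestronglyMeasurable H.isOpen_domain.measurableSet).mul
      ((H.measurable_gradient_hat m p).inner (H.measurable_gradient_hat m q)).aestronglyMeasurable
  refine IntegrableOn.of_bound H.volume_domain_lt_top hmeas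
    (A * (4 * m / H.side * (4 * m / H.side))) ?_
  filter_upwards [ae_restrict_mem H.isOpen_domain.measurableSet] with x hx
  have hs := H.side_pos
  have hAx := hA x (subset_closure hx)
  rw [norm_mul]
  refine mul_le_mul hAx ((norm_inner_le_norm _ _).trans ?_) (norm_nonneg _)
    ((norm_nonneg _).trans hAx)
  exact mul_le_mul (H.norm_gradient_hat_le m p x) (H.norm_gradient_hat_le m q x) (norm_nonneg _)
    (by positivity)

/-- The open elementary triangle with vertices `p`, `p + (1, 0)`, `p + (0, 1)`. -/
def upTriangle (m : ℕ) (p : ℤ × ℤ) : Set Plane :=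
  {x | 0 < m * H.coordU x - p.1 ∧ 0 < m * H.coordV x - p.2 ∧
    (m * H.coordU x - p.1) + (m * H.coordV x - p.2) < 1}

theorem isOpen_upTriangle (m : ℕ) (p : ℤ × ℤ) : IsOpen (H.upTriangle m p) := by
  have h1 : Continuous fun x => m * H.coordU x - p.1 :=
    (continuous_const.mul H.continuous_coordU).sub continuous_const
  have h2 : Continuous fun x => m * H.coordV x - p.2 :=
    (continuous_const.mul H.continuous_coordV).sub continuous_const
  exact (isOpen_lt continuous_const h1).inter
    ((isOpen_lt continuous_const h2).inter (isOpen_lt (h1.add h2) continuous_const))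

theorem disjoint_upTriangle (m : ℕ) {p q : ℤ × ℤ} (hpq : p ≠ q) :
    Disjoint (H.upTriangle m p) (H.upTriangle m q) := by
  rw [Set.disjoint_left]
  rintro x ⟨a1, a2, a3⟩ ⟨b1, b2, b3⟩
  apply hpq
  have key : ∀ (t : ℝ) (k l : ℤ), 0 < t - k → t - k < 1 → 0 < t - l → t - l < 1 → k = l := by
    intro t k l h1 h2 h3 h4
    have c1 : k < l + 1 := by
      have : (k : ℝ) < l + 1 := by linarith
      exact_mod_cast this
    have c2 : l < k + 1 := by
      have : (l : ℝ) < k + 1 := by linarith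
      exact_mod_cast this
    omega
  exact Prod.ext (key _ _ _ a1 (by linarith) b1 (by linarith))
    (key _ _ _ a2 (by linarith) b2 (by linarith))

theorem volume_upTriangle_ge {m : ℕ} (hm : 0 < m) (p : ℤ × ℤ) :
    ENNReal.ofReal ((H.side / (16 * m)) ^ 2 * Real.pi) ≤ volume (H.upTriangle m p) := by
  have h0 := H.side_pos
  have hm' : (0 : ℝ) < m := by exact_mod_cast hm
  -- The disk about the centroid of radius `h / 16` lies inside the triangle.
  set c : Plane := H.center + ((p.1 + 1 / 3 : ℝ) / m) • H.u + ((p.2 + 1 / 3 : ℝ) / m) • H.v with hc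
  have hball : Metric.ball c (H.side / (16 * m)) ⊆ H.upTriangle m p := by
    intro x hx
    rw [mem_ball_iff_norm] at hx
    have hU := H.abs_coordU_sub_le x c
    have hV := H.abs_coordV_sub_le x c
    have hlt : 2 / H.side * ‖x - c‖ < 1 / (8 * m) := by
      calc 2 / H.side * ‖x - c‖ < 2 / H.side * (H.side / (16 * m)) := by gcongr
        _ = _ := by field_simp; norm_num
    have scale : ∀ s t : ℝ, |s - (t + 1 / 3) / m| < 1 / (8 * m) →
        |m * s - t - 1 / 3| < 1 / 8 := by
      intro s t hst
      have e : m * s - t - 1 / 3 = m * (s - (t + 1 / 3) / m) := by field_simp; ring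
      rw [e, abs_mul, Nat.abs_cast]
      calc (m : ℝ) * _ < m * (1 / (8 * m)) := by gcongr
        _ = _ := by field_simp
    rw [hc, H.coordU_combination, ← hc] at hU
    rw [hc, H.coordV_combination, ← hc] at hV
    have hU' := abs_lt.mp (scale _ _ (hU.trans_lt hlt))
    have hV' := abs_lt.mp (scale _ _ (hV.trans_lt hlt))
    exact ⟨by linarith, by linarith, by linarith⟩
  refine le_trans (le_of_eq ?_) (measure_mono hball)
  rw [EuclideanSpace.volume_ball_fin_two, ENNReal.ofReal_mul (by positivity),
    ENNReal.ofReal_pow (by positivity)]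

theorem hat_of_mem_upTriangle {m : ℕ} {p : ℤ × ℤ} {x : Plane} (hx : x ∈ H.upTriangle m p)
    (q : ℤ × ℤ) : H.hat m q x =
      (if q = p then 1 - (m * H.coordU x - p.1) - (m * H.coordV x - p.2) else 0) +
      (if q = p + (1, 0) then m * H.coordU x - p.1 else 0) +
      (if q = p + (0, 1) then m * H.coordV x - p.2 else 0) := by
  obtain ⟨k1, k2, k3⟩ := hx
  obtain ⟨p1, p2⟩ := p
  obtain ⟨q1, q2⟩ := q
  simp only [Prod.mk_add_mk, Prod.mk.injEq, add_zero] at *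
  have val : ∀ r s t : ℝ, |s| ≤ r → |t| ≤ r → |s + t| ≤ r → (r = |s| ∨ r = |t| ∨ r = |s + t|) →
      r ≤ 1 → max 0 (1 - max |s| (max |t| |s + t|)) = 1 - r := by
    intro r s t h1 h2 h3 h4 h5
    have e : max |s| (max |t| |s + t|) = r := by
      apply le_antisymm (max_le h1 (max_le h2 h3))
      rcases h4 with h | h | h <;> rw [h] <;> simp
    rw [e, max_eq_right (by linarith)]
  by_cases c1 : q1 = p1 ∧ q2 = p2
  · obtain ⟨rfl, rfl⟩ := c1
    rw [hat, val (m * H.coordU x - q1 + (m * H.coordV x - q2))]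
    · simp
      ring
    · rw [abs_le]; constructor <;> linarith
    · rw [abs_le]; constructor <;> linarith
    · rw [abs_le]; constructor <;> linarith
    · right; right; rw [abs_of_nonneg (by linarith)]
    · linarith
  by_cases c2 : q1 = p1 + 1 ∧ q2 = p2
  · obtain ⟨rfl, rfl⟩ := c2
    rw [hat, val (1 - (m * H.coordU x - p1))] <;> push_cast
    · simp
    · rw [abs_le]; constructor <;> linarith
    · rw [abs_le]; constructor <;> linarith
    · rw [abs_le]; constructor <;> linarith
    · left; rw [abs_of_nonpos (by linarith)]; ring
    · linarith
  by_cases c3 : q1 = p1 ∧ q2 = p2 + 1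
  · obtain ⟨rfl, rfl⟩ := c3
    rw [hat, val (1 - (m * H.coordV x - p2))] <;> push_cast
    · simp
    · rw [abs_le]; constructor <;> linarith
    · rw [abs_le]; constructor <;> linarith
    · rw [abs_le]; constructor <;> linarith
    · right; left; rw [abs_of_nonpos (by linarith)]; ring
    · linarith
  rw [if_neg c1, if_neg c2, if_neg c3, add_zero, add_zero]
  by_contra hne
  obtain ⟨b1, b2, b3⟩ := H.abs_lt_of_hat_ne_zero hne
  simp only [abs_lt] at b1 b2 b3
  have d1 : q1 < p1 + 2 := by
    have : (q1 : ℝ) < p1 + 2 := by linarith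
    exact_mod_cast this
  have d2 : p1 - 1 < q1 := by
    have : (p1 - 1 : ℝ) < q1 := by linarith
    exact_mod_cast this
  have d3 : q2 < p2 + 2 := by
    have : (q2 : ℝ) < p2 + 2 := by linarith
    exact_mod_cast this
  have d4 : p2 - 1 < q2 := by
    have : (p2 - 1 : ℝ) < q2 := by linarith
    exact_mod_cast this
  have d5 : q1 + q2 < p1 + p2 + 2 := by
    have : (q1 + q2 : ℝ) < p1 + p2 + 2 := by linarith
    exact_mod_cast this
  omega

theorem hasGradientAt_coordU (x : Plane) : HasGradientAt H.coordU H.gradU x := by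
  have e : H.coordU = fun x => ⟪H.gradU, x⟫_ℝ +
      -⟪(3 * H.side ^ 2)⁻¹ • ((4 : ℝ) • H.u - (2 : ℝ) • H.v), H.center⟫_ℝ :=
    funext fun x => H.coordU_eq x
  rw [e, hasGradientAt_iff_hasFDerivAt]
  exact ((InnerProductSpace.toDual ℝ Plane H.gradU).hasFDerivAt (x := x)).add_const _

theorem hasGradientAt_coordV (x : Plane) : HasGradientAt H.coordV H.gradV x := by
  have e : H.coordV = fun x => ⟪H.gradV, x⟫_ℝ +
      -⟪(3 * H.side ^ 2)⁻¹ • ((4 : ℝ) • H.v - (2 : ℝ) • H.u), H.center⟫_ℝ :=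
    funext fun x => H.coordV_eq x
  rw [e, hasGradientAt_iff_hasFDerivAt]
  exact ((InnerProductSpace.toDual ℝ Plane H.gradV).hasFDerivAt (x := x)).add_const _

theorem gradient_hat_of_mem_upTriangle {m : ℕ} {p : ℤ × ℤ} {x : Plane}
    (hx : x ∈ H.upTriangle m p) (q : ℤ × ℤ) : gradient (H.hat m q) x =
      ((if q = p + (1, 0) then (m : ℝ) else 0) - if q = p then (m : ℝ) else 0) • H.gradU +
      ((if q = p + (0, 1) then (m : ℝ) else 0) - if q = p then (m : ℝ) else 0) • H.gradV := by
  have hev : H.hat m q =ᶠ[nhds x] fun x =>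
      ((if q = p + (1, 0) then (m : ℝ) else 0) - if q = p then (m : ℝ) else 0) * H.coordU x +
      ((if q = p + (0, 1) then (m : ℝ) else 0) - if q = p then (m : ℝ) else 0) * H.coordV x +
      ((if q = p then 1 + (p.1 : ℝ) + p.2 else 0) - (if q = p + (1, 0) then (p.1 : ℝ) else 0) -
        (if q = p + (0, 1) then (p.2 : ℝ) else 0)) := by
    filter_upwards [(H.isOpen_upTriangle m p).mem_nhds hx] with y hy
    rw [H.hat_of_mem_upTriangle hy]
    split_ifs <;> ring
  rw [hev.gradient_eq]
  apply HasGradientAt.gradient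
  rw [hasGradientAt_iff_hasFDerivAt, map_add, map_smul, map_smul]
  exact (((H.hasGradientAt_coordU x).hasFDerivAt.const_mul _).add
    ((H.hasGradientAt_coordV x).hasFDerivAt.const_mul _)).add_const _

/-- The gradient of the finite element function with nodal values `F`. -/
def femGradient (m : ℕ) (F : ℤ × ℤ → ℝ) (x : Plane) : Plane :=
  ∑ i : Node m, F i • gradient (H.hat m i) x

/-- On an elementary triangle the gradient of a finite element function is given by the increments
of its nodal values. -/
theorem femGradient_of_mem_upTriangle {m : ℕ} {p : ℤ × ℤ} {x : Plane} (hx : x ∈ H.upTriangle m p)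
    (F : ℤ × ℤ → ℝ) (hF : ∀ q ∉ internalNodes m, F q = 0) :
    H.femGradient m F x =
      (m * (F (p + (1, 0)) - F p)) • H.gradU + (m * (F (p + (0, 1)) - F p)) • H.gradV := by
  have pick : ∀ r : ℤ × ℤ,
      ∑ q ∈ internalNodes m, F q * (if q = r then (m : ℝ) else 0) = m * F r := by
    intro r
    simp only [mul_ite, mul_zero, Finset.sum_ite_eq']
    split_ifs with hr
    · ring
    · rw [hF r hr, mul_zero]
  rw [femGradient,
    Finset.sum_coe_sort (internalNodes m) fun q => F q • gradient (H.hat m q) x]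
  simp only [H.gradient_hat_of_mem_upTriangle hx, smul_add, smul_smul, mul_sub,
    Finset.sum_add_distrib, ← Finset.sum_smul, Finset.sum_sub_distrib, pick]

/-- The Dirichlet energy density of the complex finite element function with nodal values `f`. -/
def femDensity (m : ℕ) (f : ℤ × ℤ → ℂ) (x : Plane) : ℝ :=
  ‖H.femGradient m (fun p => (f p).re) x‖ ^ 2 + ‖H.femGradient m (fun p => (f p).im) x‖ ^ 2

theorem femDensity_eq_sum (m : ℕ) (f : ℤ × ℤ → ℂ) (x : Plane) :
    H.femDensity m f x = ∑ i : Node m, ∑ j : Node m,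
      ((f i).re * (f j).re + (f i).im * (f j).im) *
        (1 * ⟪gradient (H.hat m j) x, gradient (H.hat m i) x⟫_ℝ) := by
  have expand : ∀ F, ‖H.femGradient m F x‖ ^ 2 = ∑ i : Node m, ∑ j : Node m,
      F i * F j * (1 * ⟪gradient (H.hat m j) x, gradient (H.hat m i) x⟫_ℝ) := by
    intro F
    rw [← real_inner_self_eq_norm_sq, femGradient]
    simp only [sum_inner, inner_sum, real_inner_smul_left, real_inner_smul_right]
    refine Finset.sum_congr rfl fun i _ => Finset.sum_congr rfl fun j _ => ?_
    rw [real_inner_comm]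
    ring
  simp only [femDensity, expand, ← Finset.sum_add_distrib, add_mul]

theorem femDensity_ge {m : ℕ} {p : ℤ × ℤ} {x : Plane} (hx : x ∈ H.upTriangle m p)
    (f : ℤ × ℤ → ℂ) (hf : ∀ q ∉ internalNodes m, f q = 0) :
    2 / (3 * H.side ^ 2) * m ^ 2 * latticeDensity f p ≤ H.femDensity m f x := by
  rw [femDensity,
    H.femGradient_of_mem_upTriangle hx (fun p => (f p).re) fun q hq => by simp [hf q hq],
    H.femGradient_of_mem_upTriangle hx (fun p => (f p).im) fun q hq => by simp [hf q hq],
    H.norm_sq_smul_gradU_add_smul_gradV, H.norm_sq_smul_gradU_add_smul_gradV]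
  simp only [latticeDensity, ← Complex.normSq_eq_norm_sq, Complex.normSq_apply,
    Complex.sub_re, Complex.sub_im]
  generalize (f (p + (1, 0))).re - (f p).re = A
  generalize (f (p + (0, 1))).re - (f p).re = B
  generalize (f (p + (1, 0))).im - (f p).im = C
  generalize (f (p + (0, 1))).im - (f p).im = D
  -- The excess is a sum of squares, as `4/3 (A² + B² - AB) - 2/3 (A² + B²) = 2/3 (A - B)²`.
  have hpos : 0 ≤ 2 / (3 * H.side ^ 2) * (m : ℝ) ^ 2 := by positivity
  have := mul_nonneg hpos (add_nonneg (sq_nonneg (A - B)) (sq_nonneg (C - D)))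
  refine le_of_sub_nonneg (this.trans (le_of_eq ?_))
  ring

theorem integrableOn_femDensity (m : ℕ) (f : ℤ × ℤ → ℂ) :
    IntegrableOn (H.femDensity m f) H.domain := by
  rw [show H.femDensity m f = _ from funext (H.femDensity_eq_sum m f)]
  exact integrable_finsetSum _ fun i _ => integrable_finsetSum _ fun j _ =>
    (H.integrableOn_diffusion continuousOn_const m j i).const_mul _

/-- The form of the constant coefficient diffusion matrix is the Dirichlet integral. -/
theorem form_eq_integral_femDensity {m : ℕ} (y : Node m → ℂ) :
    (star y ⬝ᵥ (toComplex (H.diffusionMatrix (fun _ => 1) m)).mulVec y).re =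
      ∫ x in H.domain, H.femDensity m (zeroExtend y) x := by
  have hint : ∀ i j : Node m, IntegrableOn
      (fun x => (1 : ℝ) * ⟪gradient (H.hat m j) x, gradient (H.hat m i) x⟫_ℝ) H.domain :=
    fun i j => H.integrableOn_diffusion continuousOn_const m j i
  simp only [H.femDensity_eq_sum]
  rw [integral_finsetSum _ fun i _ => integrable_finsetSum _ fun j _ => (hint i j).const_mul _]
  simp only [dotProduct, Matrix.mulVec, Finset.mul_sum, Complex.re_sum]
  refine Finset.sum_congr rfl fun i _ => ?_
  rw [integral_finsetSum _ fun j _ => (hint i j).const_mul _]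
  refine Finset.sum_congr rfl fun j _ => ?_
  rw [integral_const_mul]
  simp only [toComplex, Matrix.map_apply, diffusionMatrix, Matrix.of_apply, zeroExtend_node,
    Pi.star_apply, RCLike.star_def, Complex.mul_re, Complex.conj_re, Complex.conj_im,
    Complex.mul_im, Complex.ofReal_re, Complex.ofReal_im]
  ring

/-- The lower corners of the triangles `upTriangle` with a vertex at an internal node. -/
def activeCells (m : ℕ) : Finset (ℤ × ℤ) :=
  internalNodes m ∪ (internalNodes m).image (· - (1, 0)) ∪ (internalNodes m).image (· - (0, 1))

theorem mem_activeCells {m : ℕ} {p : ℤ × ℤ} : p ∈ activeCells m ↔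
    p ∈ internalNodes m ∨ p + (1, 0) ∈ internalNodes m ∨ p + (0, 1) ∈ internalNodes m := by
  simp only [activeCells, Finset.mem_union, Finset.mem_image, or_assoc, sub_eq_iff_eq_add,
    exists_eq_right]

theorem upTriangle_subset_domain {m : ℕ} {p : ℤ × ℤ} (hp : p ∈ activeCells m) :
    H.upTriangle m p ⊆ H.domain := by
  rintro x ⟨k1, k2, k3⟩
  rw [mem_activeCells, mem_internalNodes, mem_internalNodes, mem_internalNodes] at hp
  obtain ⟨p1, p2⟩ := p
  simp only [Prod.mk_add_mk, abs_lt] at hp k1 k2 k3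
  have hm : (0 : ℤ) < m := by omega
  have hm' : (0 : ℝ) < m := by exact_mod_cast hm
  have bound : ∀ (t : ℝ) (k : ℤ), (k : ℝ) < m * t → m * t < k + 1 → -(m : ℤ) ≤ k → k + 1 ≤ m →
      |t| < 1 := by
    intro t k h1 h2 h3 h4
    have h3' : -(m : ℝ) ≤ k := by exact_mod_cast h3
    have h4' : (k : ℝ) + 1 ≤ m := by exact_mod_cast h4
    rw [abs_lt]
    constructor
    · by_contra hc
      nlinarith
    · by_contra hc
      nlinarith
  refine ⟨bound _ p1 (by linarith) (by linarith) (by omega) (by omega),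
    bound _ p2 (by linarith) (by linarith) (by omega) (by omega),
    bound _ (p1 + p2) ?_ ?_ (by omega) (by omega)⟩ <;> push_cast <;> linarith

theorem latticeEnergy_eq_sum {m : ℕ} (y : Node m → ℂ) :
    latticeEnergy (zeroExtend y) = ∑ p ∈ activeCells m, latticeDensity (zeroExtend y) p := by
  refine tsum_eq_sum fun p hp => ?_
  simp only [mem_activeCells, not_or] at hp
  simp [latticeDensity, zeroExtend_of_notMem y hp.1, zeroExtend_of_notMem y hp.2.1,
    zeroExtend_of_notMem y hp.2.2]

theorem latticeDensity_le_setIntegral {m : ℕ} (hm : 0 < m) {p : ℤ × ℤ} (hp : p ∈ activeCells m)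
    (f : ℤ × ℤ → ℂ) (hf : ∀ q ∉ internalNodes m, f q = 0) :
    Real.pi / 384 * latticeDensity f p ≤ ∫ x in H.upTriangle m p, H.femDensity m f x := by
  have h0 := H.side_pos
  have hm' : (0 : ℝ) < m := by exact_mod_cast hm
  have hsub := H.upTriangle_subset_domain hp
  have hvfin : volume (H.upTriangle m p) < ⊤ :=
    (measure_mono hsub).trans_lt H.volume_domain_lt_top
  have hvol : (H.side / (16 * m)) ^ 2 * Real.pi ≤ volume.real (H.upTriangle m p) := by
    rw [Measure.real, ← ENNReal.ofReal_le_iff_le_toReal hvfin.ne]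
    exact H.volume_upTriangle_ge hm p
  have hd := latticeDensity_nonneg f p
  set δ := latticeDensity f p
  calc Real.pi / 384 * δ
      = (H.side / (16 * m)) ^ 2 * Real.pi * (2 / (3 * H.side ^ 2) * m ^ 2 * δ) := by
        field_simp
        ring
    _ ≤ volume.real (H.upTriangle m p) * (2 / (3 * H.side ^ 2) * m ^ 2 * δ) := by
        gcongr
    _ = ∫ x in H.upTriangle m p, 2 / (3 * H.side ^ 2) * m ^ 2 * δ := by
        rw [setIntegral_const, smul_eq_mul]
    _ ≤ _ := setIntegral_mono_on (integrableOn_const hvfin.ne)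
        ((H.integrableOn_femDensity m f).mono_set hsub)
        (H.isOpen_upTriangle m p).measurableSet fun x hx => H.femDensity_ge hx f hf

theorem isEmpty_node_zero : IsEmpty (Node 0) :=
  ⟨fun i => absurd (mem_internalNodes.mp i.2).1 (not_lt.mpr (by simp))⟩

/-- The form of the constant coefficient diffusion matrix dominates the lattice energy, uniformly in
the mesh. -/
theorem latticeEnergy_le_form (m : ℕ) (y : Node m → ℂ) :
    Real.pi / 384 * latticeEnergy (zeroExtend y) ≤
      (star y ⬝ᵥ (toComplex (H.diffusionMatrix (fun _ => 1) m)).mulVec y).re := by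
  rw [H.form_eq_integral_femDensity, latticeEnergy_eq_sum, Finset.mul_sum]
  rcases Nat.eq_zero_or_pos m with rfl | hm
  · have he := isEmpty_node_zero
    have hempty : internalNodes 0 = ∅ := Finset.isEmpty_coe_sort.mp he
    rw [activeCells, hempty, Finset.image_empty, Finset.image_empty, Finset.empty_union,
      Finset.empty_union, Finset.sum_empty]
    exact integral_nonneg fun x => by simp only [femDensity, Pi.zero_apply]; positivity
  have hz : ∀ q ∉ internalNodes m, zeroExtend y q = 0 := fun q hq => zeroExtend_of_notMem y hq
  have hNint := H.integrableOn_femDensity m (zeroExtend y)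
  have hdisj : Set.Pairwise ((activeCells m : Finset (ℤ × ℤ)) : Set (ℤ × ℤ))
      (Function.onFun Disjoint (H.upTriangle m)) :=
    fun p _ q _ hpq => H.disjoint_upTriangle m hpq
  have hunion := integral_biUnion_finset (μ := volume) (f := H.femDensity m (zeroExtend y))
    (activeCells m) (fun p _ => (H.isOpen_upTriangle m p).measurableSet) hdisj
    fun p hp => hNint.mono_set (H.upTriangle_subset_domain hp)
  refine (Finset.sum_le_sum fun p hp => H.latticeDensity_le_setIntegral hm hp _ hz).trans ?_
  rw [← hunion]
  have hsub : ⋃ p ∈ activeCells m, H.upTriangle m p ⊆ H.domain :=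
    Set.iUnion₂_subset fun p hp => H.upTriangle_subset_domain hp
  refine setIntegral_mono_set hNint (Filter.Eventually.of_forall fun x => ?_)
    (LE.le.eventuallyLE hsub)
  simp only [femDensity, Pi.zero_apply]
  positivity

end RegularHexagon

end

noncomputable section

/-! ### The preconditioner and the imaginary part as quadratic forms -/

namespace RegularHexagon

variable (H : RegularHexagon)

theorem meshSize_nonneg (m : ℕ) : 0 ≤ H.meshSize m :=
  div_nonneg H.side_pos.le (Nat.cast_nonneg m)

theorem meshSize_le_side (m : ℕ) : H.meshSize m ≤ H.side := by
  have h0 := H.side_pos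
  rcases Nat.eq_zero_or_pos m with rfl | hm
  · simp [meshSize, h0.le]
  · exact div_le_self h0.le (by exact_mod_cast hm)

/-- The energy of a unit vector is at least `1`, from the edge leaving its node to the right. -/
theorem diffusionMatrix_one_diag_ge (m : ℕ) (i : Node m) :
    Real.pi / 384 ≤ H.diffusionMatrix (fun _ => 1) m i i := by
  set y : Node m → ℂ := Pi.single i 1 with hy
  have h := H.latticeEnergy_le_form m y
  have e1 : (star y ⬝ᵥ (toComplex (H.diffusionMatrix (fun _ => 1) m)).mulVec y).re =
      H.diffusionMatrix (fun _ => 1) m i i := by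
    simp [hy, toComplex]
  have e2 : 1 ≤ latticeEnergy (zeroExtend y) := by
    have hfin := finite_support_zeroExtend y
    have hd := sum_latticeDensity_le hfin {(i : ℤ × ℤ)}
    rw [Finset.sum_singleton] at hd
    refine le_trans ?_ hd
    have h1 : zeroExtend y i = 1 := by rw [zeroExtend_node, hy, Pi.single_eq_same]
    have h2 : zeroExtend y ((i : ℤ × ℤ) + (1, 0)) = 0 := by
      unfold zeroExtend
      split_ifs with hmem
      · rw [hy, Pi.single_eq_of_ne]
        intro he
        have := congrArg (fun q : Node m => (q : ℤ × ℤ).1) he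
        simp at this
      · rfl
    rw [latticeDensity, h1, h2]
    simp only [zero_sub, norm_neg, norm_one]
    have := sq_nonneg ‖zeroExtend y ((i : ℤ × ℤ) + (0, 1)) - 1‖
    linarith
  rw [e1] at h
  refine le_trans ?_ h
  exact le_mul_of_one_le_right (by positivity) e2

theorem diffusionMatrix_symm (a : Plane → ℝ) (m : ℕ) (i j : Node m) :
    H.diffusionMatrix a m j i = H.diffusionMatrix a m i j := by
  simp only [diffusionMatrix, Matrix.of_apply, real_inner_comm]

theorem quadDiffusionMatrix_symm (Q : H.QuadratureFamily) (a : Plane → ℝ) (m : ℕ) (i j : Node m) :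
    H.quadDiffusionMatrix Q a m j i = H.quadDiffusionMatrix Q a m i j := by
  simp only [quadDiffusionMatrix, Matrix.of_apply, real_inner_comm]

theorem diffusionMatrix_diag_ge {a : Plane → ℝ} {a₀ : ℝ} (ha : ContinuousOn a (closure H.domain))
    (ha_ge : ∀ x ∈ closure H.domain, a₀ ≤ a x) (m : ℕ) (i : Node m) :
    a₀ * H.diffusionMatrix (fun _ => 1) m i i ≤ H.diffusionMatrix a m i i := by
  simp only [diffusionMatrix, Matrix.of_apply]
  rw [← integral_const_mul]
  refine setIntegral_mono_on ((H.integrableOn_diffusion continuousOn_const m i i).const_mul _)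
    (H.integrableOn_diffusion ha m i i) H.isOpen_domain.measurableSet fun x hx => ?_
  rw [one_mul]
  exact mul_le_mul_of_nonneg_right (ha_ge x (subset_closure hx)) real_inner_self_nonneg

theorem IsDiffusionSequence.symm {a : Plane → ℝ} {Θ : (m : ℕ) → Matrix (Node m) (Node m) ℝ}
    (hΘ : H.IsDiffusionSequence a Θ) (m : ℕ) (i j : Node m) : Θ m j i = Θ m i j := by
  rcases hΘ with rfl | ⟨Q, rfl, -, -⟩
  · exact H.diffusionMatrix_symm a m i j
  · exact H.quadDiffusionMatrix_symm Q a m i j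

/-- The diagonal scaling is bounded below uniformly in the mesh. For matrices computed by quadrature
this follows from the error bound on fine meshes, and from positivity on the finitely many others. -/
theorem IsDiffusionSequence.exists_scaling_ge {a : Plane → ℝ} {a₀ : ℝ}
    {Θ : (m : ℕ) → Matrix (Node m) (Node m) ℝ} (hΘ : H.IsDiffusionSequence a Θ) (ha₀ : 0 < a₀)
    (ha : ContinuousOn a (closure H.domain)) (ha_ge : ∀ x ∈ closure H.domain, a₀ ≤ a x) :
    ∃ d : ℝ, 0 < d ∧ ∀ m i, d ≤ Θ m i i / H.diffusionMatrix (fun _ => 1) m i i := by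
  have hκ : 0 < Real.pi / 384 := by positivity
  have hK : ∀ m i, 0 < H.diffusionMatrix (fun _ => 1) m i i := fun m i =>
    hκ.trans_le (H.diffusionMatrix_one_diag_ge m i)
  rcases hΘ with rfl | ⟨Q, -, ⟨C, hC⟩, hpos⟩
  · exact ⟨a₀, ha₀, fun m i => (le_div_iff₀ (hK m i)).mpr (H.diffusionMatrix_diag_ge ha ha_ge m i)⟩
  have hlim : Filter.Tendsto (fun m : ℕ => C * H.meshSize m ^ 2) Filter.atTop (nhds 0) := by
    have h1 : Filter.Tendsto H.meshSize Filter.atTop (nhds 0) :=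
      tendsto_const_div_atTop_nhds_zero_nat H.side
    simpa using (h1.pow 2).const_mul C
  have hev : ∀ᶠ m : ℕ in Filter.atTop, C * H.meshSize m ^ 2 < a₀ / 2 * (Real.pi / 384) :=
    hlim.eventually_lt_const (by positivity)
  obtain ⟨M, hM⟩ := Filter.eventually_atTop.mp hev
  have hfine : ∀ m ≥ M, ∀ i, a₀ / 2 ≤ Θ m i i / H.diffusionMatrix (fun _ => 1) m i i := by
    intro m hm i
    rw [le_div_iff₀ (hK m i)]
    have h1 := (abs_le.mp (hC m i i)).1
    have h2 := H.diffusionMatrix_diag_ge ha ha_ge m i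
    have h3 := hM m hm
    have h4 := mul_le_mul_of_nonneg_left (H.diffusionMatrix_one_diag_ge m i)
      (show 0 ≤ a₀ / 2 by positivity)
    linarith
  have hcoarse : ∀ m, ∃ d : ℝ, 0 < d ∧
      ∀ i, d ≤ Θ m i i / H.diffusionMatrix (fun _ => 1) m i i := by
    intro m
    rcases isEmpty_or_nonempty (Node m) with he | hne
    · exact ⟨1, one_pos, fun i => he.elim i⟩
    · obtain ⟨i₀, hi₀⟩ := Finite.exists_min
        fun i : Node m => Θ m i i / H.diffusionMatrix (fun _ => 1) m i i
      exact ⟨_, div_pos (hpos m i₀) (hK m i₀), hi₀⟩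
  choose d hd hdle using hcoarse
  have hne : (Finset.range (M + 1)).Nonempty := ⟨0, by simp⟩
  refine ⟨min (a₀ / 2) ((Finset.range (M + 1)).inf' hne d), ?_, fun m i => ?_⟩
  · exact lt_min (by positivity) ((Finset.lt_inf'_iff hne).mpr fun m _ => hd m)
  · rcases le_or_gt M m with h | h
    · exact (min_le_left _ _).trans (hfine m h i)
    · exact (min_le_right _ _).trans ((Finset.inf'_le d (by simp; omega)).trans (hdle m i))

theorem IsConvectionSequence.sparse {b : Plane → Plane}
    {Ψ : (m : ℕ) → Matrix (Node m) (Node m) ℝ} (hΨ : H.IsConvectionSequence b Ψ) {m : ℕ}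
    {i j : Node m} (hij : i ≠ j) (h : (j : ℤ × ℤ) - i ∉ latticeDirections) : Ψ m i j = 0 := by
  rcases hΨ with rfl | ⟨Q, rfl, -⟩
  · exact H.convectionMatrix_sparse b hij h
  · exact H.quadConvectionMatrix_sparse Q b hij h

theorem IsConvectionSequence.exists_abs_le {b : Plane → Plane}
    {Ψ : (m : ℕ) → Matrix (Node m) (Node m) ℝ} (hΨ : H.IsConvectionSequence b Ψ)
    (hb : ContinuousOn b (closure H.domain)) :
    ∃ C : ℝ, 0 ≤ C ∧ ∀ m i j, |Ψ m i j| ≤ C * H.meshSize m := by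
  obtain ⟨C, hC0, hC⟩ := H.exists_abs_convectionMatrix_le hb
  rcases hΨ with rfl | ⟨Q, -, ⟨C', hC'⟩⟩
  · exact ⟨C, hC0, hC⟩
  have h0 := H.side_pos
  refine ⟨C + |C'| * H.side, by positivity, fun m i j => ?_⟩
  have hh := H.meshSize_nonneg m
  have h1 : C' * H.meshSize m ^ 2 ≤ |C'| * H.side * H.meshSize m := by
    calc C' * H.meshSize m ^ 2 ≤ |C'| * H.meshSize m ^ 2 := by gcongr; exact le_abs_self C'
      _ = |C'| * H.meshSize m * H.meshSize m := by ring
      _ ≤ |C'| * H.side * H.meshSize m := by gcongr; exact H.meshSize_le_side m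
  have h2 := abs_add_le (Ψ m i j - H.convectionMatrix b m i j) (H.convectionMatrix b m i j)
  rw [sub_add_cancel] at h2
  have := hC m i j
  have := hC' m i j
  linarith

/-- The diagonal of `D^{1/2}`. -/
def scaling (m : ℕ) (Θ : Matrix (Node m) (Node m) ℝ) (i : Node m) : ℝ :=
  √(Θ i i / H.diffusionMatrix (fun _ => 1) m i i)

theorem preconditioner_apply (m : ℕ) (Θ : Matrix (Node m) (Node m) ℝ) (i j : Node m) :
    H.preconditioner m Θ i j =
      H.scaling m Θ i * H.diffusionMatrix (fun _ => 1) m i j * H.scaling m Θ j := by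
  simp only [preconditioner, Matrix.mul_diagonal, Matrix.diagonal_mul, scaling]

/-- Multiplication by `D^{1/2}` on complex vectors. -/
def scale (m : ℕ) (Θ : Matrix (Node m) (Node m) ℝ) : (Node m → ℂ) →ₗ[ℂ] (Node m → ℂ) :=
  (Matrix.diagonal fun i => (H.scaling m Θ i : ℂ)).mulVecLin

theorem scale_apply (m : ℕ) (Θ : Matrix (Node m) (Node m) ℝ) (g : Node m → ℂ) (i : Node m) :
    H.scale m Θ g i = H.scaling m Θ i * g i := by
  simp [scale, Matrix.mulVec_diagonal]

theorem preconditioner_form (m : ℕ) (Θ : Matrix (Node m) (Node m) ℝ) (g : Node m → ℂ) :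
    star g ⬝ᵥ (toComplex (H.preconditioner m Θ)).mulVec g =
      star (H.scale m Θ g) ⬝ᵥ
        (toComplex (H.diffusionMatrix (fun _ => 1) m)).mulVec (H.scale m Θ g) := by
  simp only [dotProduct, Matrix.mulVec, Finset.mul_sum]
  refine Finset.sum_congr rfl fun i _ => Finset.sum_congr rfl fun j _ => ?_
  simp only [Pi.star_apply, scale_apply, toComplex, Matrix.map_apply, preconditioner_apply,
    RCLike.star_def, map_mul, Complex.conj_ofReal, Complex.ofReal_mul]
  ring

theorem latticeEnergy_le_preconditioner_form (m : ℕ) (Θ : Matrix (Node m) (Node m) ℝ)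
    (g : Node m → ℂ) : Real.pi / 384 * latticeEnergy (zeroExtend (H.scale m Θ g)) ≤
      (star g ⬝ᵥ (toComplex (H.preconditioner m Θ)).mulVec g).re := by
  rw [preconditioner_form]
  exact H.latticeEnergy_le_form m _

theorem preconditioner_form_pos {m : ℕ} {Θ : Matrix (Node m) (Node m) ℝ}
    (hΘ : ∀ i, 0 < H.scaling m Θ i) {g : Node m → ℂ} (hg : g ≠ 0) :
    0 < (star g ⬝ᵥ (toComplex (H.preconditioner m Θ)).mulVec g).re := by
  refine lt_of_lt_of_le ?_ (H.latticeEnergy_le_preconditioner_form m Θ g)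
  obtain ⟨i, hi⟩ := Function.ne_iff.mp hg
  have h1 : 0 < ∑ j, ‖H.scale m Θ g j‖ ^ 2 := by
    refine Finset.sum_pos' (fun _ _ => by positivity) ⟨i, Finset.mem_univ i, ?_⟩
    have : H.scale m Θ g i ≠ 0 := by
      rw [scale_apply]
      exact mul_ne_zero (by exact_mod_cast (hΘ i).ne') hi
    positivity
  have h2 : 0 < latticeEnergy (zeroExtend (H.scale m Θ g)) := by
    by_contra hc
    have := sum_sq_le_latticeEnergy (H.scale m Θ g)
    nlinarith [sq_nonneg (2 * (m : ℝ)), not_lt.mp hc]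
  positivity

theorem posDef_preconditioner {m : ℕ} {Θ : Matrix (Node m) (Node m) ℝ}
    (hΘ : ∀ i, 0 < H.scaling m Θ i) : (H.preconditioner m Θ).PosDef := by
  refine Matrix.PosDef.of_dotProduct_mulVec_pos ?_ fun x hx => ?_
  · ext i j
    rw [Matrix.conjTranspose_apply, preconditioner_apply, preconditioner_apply,
      H.diffusionMatrix_symm, star_trivial]
    ring
  · have h := H.preconditioner_form_pos hΘ (g := fun i => (x i : ℂ)) fun h0 =>
      hx (funext fun i => Complex.ofReal_eq_zero.mp (congrFun h0 i))
    refine lt_of_lt_of_eq h ?_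
    simp [dotProduct, Matrix.mulVec, toComplex, Finset.mul_sum]

end RegularHexagon

theorem isHermitian_imPart {ι : Type*} (A : Matrix ι ι ℂ) : (imPart A).IsHermitian := by
  ext i j
  simp only [imPart, Matrix.conjTranspose_apply, Matrix.smul_apply, Matrix.sub_apply, smul_eq_mul,
    star_mul', star_sub, star_inv₀, star_star]
  simp only [RCLike.star_def, map_ofNat, Complex.conj_I]
  rw [mul_neg, inv_neg]
  ring

namespace RegularHexagon

variable (H : RegularHexagon)

/-- The form of the imaginary part gains one derivative after scaling. The diagonal scaling preserves
skew-symmetry and sparsity, so no smoothness of the diffusion coefficient is needed. -/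
theorem exists_abs_imPart_form_le {a : Plane → ℝ} {b : Plane → Plane} {a₀ : ℝ}
    {Θ Ψ : (m : ℕ) → Matrix (Node m) (Node m) ℝ} (ha₀ : 0 < a₀)
    (ha : ContinuousOn a (closure H.domain)) (ha_ge : ∀ x ∈ closure H.domain, a₀ ≤ a x)
    (hb : ContinuousOn b (closure H.domain))
    (hΘ : H.IsDiffusionSequence a Θ) (hΨ : H.IsConvectionSequence b Ψ) :
    ∃ C : ℝ, 0 ≤ C ∧ ∀ m (g : Node m → ℂ),
      |(star g ⬝ᵥ (imPart (toComplex (Θ m + Ψ m))).mulVec g).re| ≤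
        C * H.meshSize m * (√(∑ i, ‖H.scale m (Θ m) g i‖ ^ 2) *
          √(latticeEnergy (zeroExtend (H.scale m (Θ m) g)))) := by
  obtain ⟨d, hd, hdle⟩ := IsDiffusionSequence.exists_scaling_ge H hΘ ha₀ ha ha_ge
  obtain ⟨B, hB0, hB⟩ := IsConvectionSequence.exists_abs_le H hΨ hb
  refine ⟨12 * (B / d), by positivity, fun m g => ?_⟩
  have hh := H.meshSize_nonneg m
  set w := H.scaling m (Θ m) with hw
  have hwd : ∀ i, √d ≤ w i := fun i => Real.sqrt_le_sqrt (hdle m i)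
  have hw0 : ∀ i, 0 < w i := fun i => (Real.sqrt_pos.mpr hd).trans_le (hwd i)
  have hww : ∀ i j, d ≤ w i * w j := fun i j => by
    calc d = √d * √d := (Real.mul_self_sqrt hd.le).symm
      _ ≤ w i * w j := mul_le_mul (hwd i) (hwd j) (Real.sqrt_nonneg d) (hw0 i).le
  set R : Matrix (Node m) (Node m) ℝ :=
    Matrix.of fun i j => (Ψ m i j - Ψ m j i) / 2 / (w i * w j) with hR
  have hskew : ∀ i j, R j i = -R i j := fun i j => by
    simp only [hR, Matrix.of_apply, mul_comm (w j)]
    ring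
  have hsize : ∀ i j, |R i j| ≤ B / d * H.meshSize m := fun i j => by
    have hpos := mul_pos (hw0 i) (hw0 j)
    rw [hR, Matrix.of_apply, abs_div, abs_of_pos hpos, div_le_iff₀ hpos]
    have h1 : |(Ψ m i j - Ψ m j i) / 2| ≤ B * H.meshSize m := by
      rw [abs_div, abs_two, div_le_iff₀ two_pos]
      refine (abs_sub _ _).trans ?_
      linarith [hB m i j, hB m j i]
    calc _ ≤ B * H.meshSize m := h1
      _ = B / d * H.meshSize m * d := by field_simp
      _ ≤ _ := by gcongr; exact hww i j
  have hsparse : ∀ i j : Node m, i ≠ j → (j : ℤ × ℤ) - i ∉ latticeDirections → R i j = 0 := by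
    intro i j hij h
    have h' : (i : ℤ × ℤ) - j ∉ latticeDirections := by
      intro hmem
      apply h
      rw [← neg_sub]
      revert hmem
      generalize (i : ℤ × ℤ) - j = e
      simp only [latticeDirections, Finset.mem_insert, Finset.mem_singleton]
      rintro (rfl | rfl | rfl | rfl | rfl | rfl) <;> decide
    rw [hR, Matrix.of_apply, IsConvectionSequence.sparse H hΨ hij h,
      IsConvectionSequence.sparse H hΨ hij.symm h']
    simp
  have key := norm_skew_stencil_le R hskew hsize hsparse (H.scale m (Θ m) g)
  have hform : star g ⬝ᵥ (imPart (toComplex (Θ m + Ψ m))).mulVec g =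
      Complex.I⁻¹ * ∑ i, ∑ j, star (H.scale m (Θ m) g i) * (R i j * H.scale m (Θ m) g j) := by
    simp only [dotProduct, Matrix.mulVec, Finset.mul_sum]
    refine Finset.sum_congr rfl fun i _ => Finset.sum_congr rfl fun j _ => ?_
    have hi : (w i : ℂ) ≠ 0 := by exact_mod_cast (hw0 i).ne'
    have hj : (w j : ℂ) ≠ 0 := by exact_mod_cast (hw0 j).ne'
    simp only [Pi.star_apply, scale_apply, ← hw, hR, imPart, toComplex, Matrix.smul_apply,
      Matrix.sub_apply, Matrix.conjTranspose_apply, Matrix.map_apply, Matrix.add_apply,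
      Matrix.of_apply, RCLike.star_def, map_mul, Complex.conj_ofReal, smul_eq_mul,
      IsDiffusionSequence.symm H hΘ m i j]
    push_cast
    field_simp
    ring
  calc _ ≤ _ := Complex.abs_re_le_norm _
    _ = ‖∑ i, ∑ j, star (H.scale m (Θ m) g i) * (R i j * H.scale m (Θ m) g j)‖ := by
        rw [hform, norm_mul, norm_inv, Complex.norm_I, inv_one, one_mul]
    _ ≤ _ := key
    _ = _ := by ring

/-- A Poincaré inequality for the scaled vector bounds the imaginary part by the preconditioner. -/
theorem abs_imPart_form_lt {m : ℕ} {Θ : Matrix (Node m) (Node m) ℝ} {E : Matrix (Node m) (Node m) ℂ}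
    {C κ ε : ℝ} (hC : 0 ≤ C) (hκ : 0 ≤ κ) {g : Node m → ℂ}
    (hE : |(star g ⬝ᵥ E.mulVec g).re| ≤
        C * H.meshSize m * (√(∑ i, ‖H.scale m Θ g i‖ ^ 2) *
          √(latticeEnergy (zeroExtend (H.scale m Θ g)))))
    (hκg : ∑ i, ‖H.scale m Θ g i‖ ^ 2 ≤ κ ^ 2 * latticeEnergy (zeroExtend (H.scale m Θ g)))
    (hpos : 0 < (star g ⬝ᵥ (toComplex (H.preconditioner m Θ)).mulVec g).re)
    (hε : C * H.meshSize m * κ < ε * (Real.pi / 384)) :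
    |(star g ⬝ᵥ E.mulVec g).re| <
      ε * (star g ⬝ᵥ (toComplex (H.preconditioner m Θ)).mulVec g).re := by
  have hP := H.latticeEnergy_le_preconditioner_form m Θ g
  have hpi : 0 < Real.pi / 384 := by positivity
  have hh := H.meshSize_nonneg m
  set e := latticeEnergy (zeroExtend (H.scale m Θ g)) with he
  set P := (star g ⬝ᵥ (toComplex (H.preconditioner m Θ)).mulVec g).re
  have he0 : 0 ≤ e := latticeEnergy_nonneg _
  have h1 : √(∑ i, ‖H.scale m Θ g i‖ ^ 2) * √e ≤ κ * e := by
    calc √(∑ i, ‖H.scale m Θ g i‖ ^ 2) * √e ≤ √(κ ^ 2 * e) * √e := by gcongr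
      _ = κ * e := by
        rw [Real.sqrt_mul (sq_nonneg κ), Real.sqrt_sq hκ, mul_assoc, Real.mul_self_sqrt he0]
  have h2 : |(star g ⬝ᵥ E.mulVec g).re| ≤ C * H.meshSize m * κ * e :=
    hE.trans ((mul_le_mul_of_nonneg_left h1 (by positivity)).trans (le_of_eq (by ring)))
  have h3 : C * H.meshSize m * κ * (Real.pi / 384 * e) ≤ C * H.meshSize m * κ * P :=
    mul_le_mul_of_nonneg_left hP (by positivity)
  have h4 : C * H.meshSize m * κ * P < ε * (Real.pi / 384) * P := by gcongr
  have h5 : Real.pi / 384 * |(star g ⬝ᵥ E.mulVec g).re| < Real.pi / 384 * (ε * P) := by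
    calc _ ≤ Real.pi / 384 * (C * H.meshSize m * κ * e) := by gcongr
      _ = C * H.meshSize m * κ * (Real.pi / 384 * e) := by ring
      _ < _ := lt_of_le_of_lt h3 h4
      _ = _ := by ring
  exact lt_of_mul_lt_mul_left h5 hpi.le

end RegularHexagon

end

/-! ### Boundedness and clustering of the spectrum -/

theorem mainTheorem3 (H : RegularHexagon) (a : Plane → ℝ) (b : Plane → Plane) (a₀ : ℝ)
    (ha₀ : 0 < a₀)
    (ha : ContDiffOn ℝ 2 a (closure H.domain))
    (ha_ge : ∀ x ∈ closure H.domain, a₀ ≤ a x)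
    (hb : ContDiffOn ℝ 1 b (closure H.domain))
    (hb_div : ∀ x ∈ H.domain, 0 ≤ divergence b x)
    (Θ Ψ : (m : ℕ) → Matrix (Node m) (Node m) ℝ)
    (hΘ : H.IsDiffusionSequence a Θ)
    (hΨ : H.IsConvectionSequence b Ψ) :
    (∀ m, (H.preconditioner m (Θ m)).PosDef) ∧
    (∀ m, (imPart (toComplex (Θ m + Ψ m))).IsHermitian) ∧
    SpectrallyBounded (fun m =>
      (toComplex (H.preconditioner m (Θ m)))⁻¹ * imPart (toComplex (Θ m + Ψ m))) ∧
    ProperlyClustered (fun m =>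
      (toComplex (H.preconditioner m (Θ m)))⁻¹ * imPart (toComplex (Θ m + Ψ m))) 0 := by
  obtain ⟨d, hd, hdle⟩ :=
    RegularHexagon.IsDiffusionSequence.exists_scaling_ge H hΘ ha₀ ha.continuousOn ha_ge
  have hscal : ∀ m i, 0 < H.scaling m (Θ m) i := fun m i =>
    Real.sqrt_pos.mpr (hd.trans_le (hdle m i))
  have hpd : ∀ m, (H.preconditioner m (Θ m)).PosDef := fun m => H.posDef_preconditioner (hscal m)
  obtain ⟨C, hC0, hC⟩ := H.exists_abs_imPart_form_le ha₀ ha.continuousOn ha_ge hb.continuousOn hΘ hΨ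
  have hs := H.side_pos
  have hpi : 0 < Real.pi / 384 := by positivity
  refine ⟨hpd, fun m => isHermitian_imPart _, ?_, ?_⟩
  · set ε := (C * (2 * H.side) + 1) / (Real.pi / 384) with hε
    refine ⟨ε, fun m z hz => ?_⟩
    classical
    have hroots := card_roots_inv_mul_le (hpd m) (isHermitian_imPart (toComplex (Θ m + Ψ m)))
      (0 : (Node m → ℂ) →ₗ[ℂ] (Empty → ℂ)) (ε := ε) (fun g hg _ => ?_) (fun z => ε ≤ ‖z‖)
      fun _ h => h
    · by_contra hlt
      rw [Fintype.card_empty, mul_zero, Nat.le_zero, Multiset.card_eq_zero,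
        Multiset.filter_eq_nil] at hroots
      exact hroots z hz (not_le.mp hlt).le
    · refine H.abs_imPart_form_lt hC0 (κ := 2 * m) (by positivity) (hC m g)
        (sum_sq_le_latticeEnergy _) (H.preconditioner_form_pos (hscal m) hg) ?_
      rw [hε, div_mul_cancel₀ _ hpi.ne']
      have : H.meshSize m * (2 * m) ≤ 2 * H.side := by
        rcases Nat.eq_zero_or_pos m with rfl | hm
        · simp [hs.le]
        · have hm' : (0 : ℝ) < m := by exact_mod_cast hm
          rw [RegularHexagon.meshSize]
          exact le_of_eq (by field_simp)
      have := mul_le_mul_of_nonneg_left this hC0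
      linarith
  · classical
    intro ε hε
    obtain ⟨r, hr⟩ := exists_nat_gt (C * (4 * H.side) / (ε * (Real.pi / 384)))
    have hεpi : 0 < ε * (Real.pi / 384) := by positivity
    have hr0 : (0 : ℝ) < r := lt_of_le_of_lt (by positivity) hr
    have hrn : 0 < r := by exact_mod_cast hr0
    rw [div_lt_iff₀ hεpi] at hr
    -- Meshes with `m < r` are finite in number; the others are cut into squares of `k × k` nodes,
    -- `k = ⌊m / r⌋ + 1`, on each of which vectors of mean zero are considered.
    refine ⟨max ((Finset.range r).sup fun m => Multiset.card (Multiset.filter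
      (fun z => z ∉ Metric.ball (0 : ℂ) ε) ((toComplex (H.preconditioner m (Θ m)))⁻¹ *
        imPart (toComplex (Θ m + Ψ m))).charpoly.roots))
      (2 * Fintype.card (BlockIndex r)), fun m => ?_⟩
    rcases lt_or_ge m r with hmr | hmr
    · refine le_max_of_le_left ?_
      exact Finset.le_sup (f := fun m => Multiset.card (Multiset.filter
        (fun z => z ∉ Metric.ball (0 : ℂ) ε) ((toComplex (H.preconditioner m (Θ m)))⁻¹ *
          imPart (toComplex (Θ m + Ψ m))).charpoly.roots)) (Finset.mem_range.mpr hmr)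
    · refine le_max_of_le_right ?_
      set k := m / r + 1 with hk
      have hkm : m ≤ r * k := by
        have := Nat.lt_mul_div_succ m hrn
        exact this.le
      have hm' : (0 : ℝ) < m := by exact_mod_cast hrn.trans_le hmr
      have hkr : (k : ℝ) * r ≤ 2 * m := by
        have h1 : k * r ≤ 2 * m := by
          have := Nat.div_mul_le_self m r
          rw [hk, add_mul, one_mul]
          omega
        exact_mod_cast h1
      refine card_roots_inv_mul_le (hpd m) (isHermitian_imPart _)
        (blockSums m k r ∘ₗ H.scale m (Θ m)) (ε := ε) (fun g hg hL => ?_) _ fun z hz => ?_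
      · refine H.abs_imPart_form_lt hC0 (κ := 2 * k) (by positivity) (hC m g) ?_
          (H.preconditioner_form_pos (hscal m) hg) ?_
        · refine (sum_sq_le_of_blockSums_eq_zero (Nat.succ_pos _) hkm hL).trans ?_
          refine mul_le_mul_of_nonneg_right ?_ (latticeEnergy_nonneg _)
          nlinarith [sq_nonneg (k : ℝ)]
        · have h2 : H.meshSize m * (2 * k) * r ≤ 4 * H.side := by
            rw [RegularHexagon.meshSize]
            calc H.side / m * (2 * k) * r = 2 * H.side * (k * r) / m := by ring
              _ ≤ 2 * H.side * (2 * m) / m := by gcongr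
              _ = _ := by field_simp; norm_num
          have h3 := mul_le_mul_of_nonneg_left h2 hC0
          refine lt_of_mul_lt_mul_right (a := (r : ℝ)) ?_ hr0.le
          linarith
      · simpa using hz
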